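/- **Setting.** For a nondegenerate triangle $\triangle=[v_1,v_2,v_3]\subset\mathbb R^2$ put $v_4=\frac{v_1+v_2}2$, $v_5=\frac{v_2+v_3}2$, $v_6=\frac{v_1+v_3}2$, $v_7=\frac{v_4+v_6}2$, $v_8=\frac{v_4+v_5}2$, $v_9=\frac{v_5+v_6}2$, $v_{10}=\frac{v_1+v_2+v_3}3$; these are the vertices of the Powell–Sabin 12-split of $\triangle$, obtained by joining the corners and edge midpoints by all line segments. For a finite multiset $K=\{v_1^{m_1}\cdots v_{10}^{m_{10}}\}$ the area normalized simplex spline $Q[K]$ is defined recursively: $Q[K]=0$ if $\mathrm{area}([K])=0$; $Q[K]=\frac{\mathrm{area}(\triangle)}{\mathrm{area}([K])}\mathbf 1_{[K)}$ if $|K|=3$ and $\mathrm{area}([K])\ne0$; and $Q[K](x)=\sum_j\beta_jQ[K\setminus v_j](x)$ if $|K|>3$ and $\mathrm{area}([K])\ne0$, where $x=\sum_j\beta_jv_j$, $\sum_j\beta_j=1$ and $\beta_j=0$ whenever $m_j=0$ (the value does not depend on the choice of the $\beta_j$). Here $[K]$ is the convex hull, and $[K)$ is the half-open convex hull, for a fixed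 scheme that assigns every point of $\triangle$ to exactly one face of the 12-split containing it. Write $(ijklmn)$ for $Q[v_1^iv_2^jv_3^kv_4^lv_5^mv_6^n]$. Let $Q_1,\dots,Q_{25}$ be, in this order, $$(600101),(500201),(410201),(320201),(230210),(140210),(050210),(060110),$$ $$(500102),(411101),(311201),(220211),(131210),(141110),(050120),$$ $$(401102),(311102),(211211),(121211),(131120),(041120),$$ $$(302102),(211112),(121121),(032120),$$ and let $Q_{26},\dots,Q_{39}$ be, in any fixed order, $(202112)$, $(112121)$, $(112112)$, $(022121)$, $(203012)$, $(114011)$, $(113021)$, $(113012)$, $(023021)$, $(104012)$, $(014021)$, $(006011)$, $(005021)$, $(005012)$. The symmetries of $\triangle$ permute these 39 splines; let the weight $w_i$ of $Q_i$ be $\frac14$ on the orbits of $(600101)$ and $(500201)$, $\frac12$ on those of $(410201)$, $(320201)$ and $(131210)$, $\frac34$ on those of $(220211)$ and $(121211)$, and $1$ on that of $(141110)$. Then $\mathcal B_c=\{w_iQ_i\}_{i=1}^{39}$. **Theorem.** Let $\triangle=[v_1,v_2,v_3]$ and $\tilde\triangle=[v_1,v_2,\tilde v_3]$ be nondegenerate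 triangles in $\mathbb R^2$ with $\triangle\cap\tilde\triangle=e:=[v_1,v_2]$, let $(\beta_1,\beta_2,\beta_3)$ be the barycentric coordinates of $\tilde v_3$ with respect to $\triangle$, and let $\tilde Q_i$ be the splines $Q_i$ for $\tilde\triangle$ (with vertices in the order $v_1,v_2,\tilde v_3$). For real coefficients $c_i,\tilde c_i$ ($1\le i\le39$) put $f=\sum_{i=1}^{39}c_iw_iQ_i$ on $\triangle$ and $\tilde f=\sum_{i=1}^{39}\tilde c_iw_i\tilde Q_i$ on $\tilde\triangle$. Say that $f$ and $\tilde f$ meet with $C^r$ smoothness if they agree on $e$ and the function on $\triangle\cup\tilde\triangle$ that they form is of class $C^r$ at every point of $e$. Then $f$ and $\tilde f$ meet with $C^0$ smoothness if and only if $\tilde c_i=c_i$ for $i=1,\dots,8$; $C^1$ smoothness if and only if in addition $$\tilde c_{9} = \beta_1 c_{1} + \beta_2 c_{2} + \beta_3 c_{9},$$ $$\tilde c_{10} = \beta_1 c_{2} + \beta_2 c_{3} + \beta_3 c_{10},$$ $$\tilde c_{11} = \beta_1 (2 c_{3} - c_{2}) + \beta_2 c_{4} + \beta_3 c_{11},$$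 $$\tilde c_{12} = \beta_1 \frac{2 c_{4} + c_{5}}{3} + \beta_2 \frac{c_{4} + 2 c_{5}}{3} + \beta_3 c_{12},$$ $$\tilde c_{13} = \beta_1 c_{5} + \beta_2 (2 c_{6} - c_{7}) + \beta_3 c_{13},$$ $$\tilde c_{14} = \beta_1 c_{6} + \beta_2 c_{7} + \beta_3 c_{14},$$ $$\tilde c_{15} = \beta_1 c_{7} + \beta_2 c_{8} + \beta_3 c_{15},$$ $C^2$ smoothness if and only if in addition $$\tilde c_{16} = \beta_1^2 c_{1} + 2 \beta_1 \beta_2 c_{2} + \beta_2^2 c_{3} + 2 \beta_1 \beta_3 c_{9} + 2 \beta_2 \beta_3 c_{10} + \beta_3^2 c_{16},$$ $$\tilde c_{17} = \beta_1^2 c_{2} + \beta_2^2 c_{4} + \beta_3^2 c_{17} + 2 \beta_1 \beta_2 \frac{3 c_{3} - c_{2}}{2} + 2 \beta_1 \beta_3 \frac{3 c_{10} - c_{2}}{2} + 2 \beta_2 \beta_3 \frac{c_{10} + 2 c_{11} - c_{3}}{2},$$ $$\tilde c_{18} = \beta_1^2 \frac{2 c_{3} + 2 c_{4} - c_{2}}{3}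 + \beta_2^2 \frac{c_{4} + 2 c_{5}}{3} + \beta_3^2 c_{18} + 2 \beta_1 \beta_2 \frac{c_{2} - 2 c_{3} + 6 c_{4} + c_{5}}{6} + 2 \beta_1 \beta_3 \frac{c_{2} - 2 c_{3} + 2 c_{4} - c_{5} + 3 c_{11} + 3 c_{12}}{6} + 2 \beta_2 \beta_3 \frac{9 c_{12} - 2 c_{5} - c_{11}}{6},$$ $$\tilde c_{19} = \beta_1^2 \frac{2 c_{4} + c_{5}}{3} + \beta_2^2 \frac{2 c_{5} + 2 c_{6} - c_{7}}{3} + \beta_3^2 c_{19} + 2 \beta_1 \beta_2 \frac{c_{4} + 6 c_{5} - 2 c_{6} + c_{7}}{6} + 2 \beta_2 \beta_3 \frac{c_{7} - 2 c_{6} + 2 c_{5} - c_{4} + 3 c_{13} + 3 c_{12}}{6} + 2 \beta_1 \beta_3 \frac{9 c_{12} - 2 c_{4} - c_{13}}{6},$$ $$\tilde c_{20} = \beta_1^2 c_{5} + \beta_2^2 c_{7} + \beta_3^2 c_{20} + 2 \beta_1 \beta_2 \frac{3 c_{6} - c_{7}}{2} + 2 \beta_1 \beta_3 \frac{c_{14}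 + 2 c_{13} - c_{6}}{2} + 2 \beta_2 \beta_3 \frac{3 c_{14} - c_{7}}{2},$$ $$\tilde c_{21} = \beta_1^2 c_{6} + 2 \beta_1 \beta_2 c_{7} + \beta_2^2 c_{8} + 2 \beta_1 \beta_3 c_{14} + 2 \beta_2 \beta_3 c_{15} + \beta_3^2 c_{21},$$ $C^3$ smoothness if and only if in addition $$\tilde c_{22} = \beta_1^3 c_{1} + 3 \beta_1^2 \beta_2 \frac{4 c_{2} - c_{1}}{3} + 3 \beta_1 \beta_2^2 \frac{5 c_{3} - 2 c_{2}}{3} + \beta_2^3 c_{4} + 3 \beta_2^2 \beta_3 \frac{c_{10} - c_{3} + 3 c_{11}}{3} + 3 \beta_2 \beta_3^2 \frac{c_{10} - c_{16} + 3 c_{17}}{3} + \beta_3^3 c_{22} + 3 \beta_3^2 \beta_1 \frac{5 c_{16} - 2 c_{9}}{3} + 3 \beta_3 \beta_1^2 \frac{4 c_{9} - c_{1}}{3} + 6 \beta_1 \beta_2 \beta_3 \frac{5 c_{10} - c_{2} - c_{9}}{3},$$ $$\tilde c_{23} = \beta_1^3 \frac{c_{2} + 2 c_{3}}{3} + 3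 \beta_1^2 \beta_2 \frac{-2 c_{2} + 8 c_{3} + 3 c_{4}}{9} + 3 \beta_1 \beta_2^2 \frac{c_{2} - c_{3} + 8 c_{4} + c_{5}}{9} + \beta_2^3 \frac{c_{4} + 2 c_{5}}{3} + 3 \beta_2^2 \beta_3 \frac{c_{10} + 15 c_{12} - c_{3} - 2 c_{4} - 4 c_{5}}{9} + 3 \beta_2 \beta_3^2 \frac{-6 c_{12} + 2 c_{17} + 12 c_{18} - c_{4} + 2 c_{5}}{9} + 3 \beta_1 \beta_3^2 \frac{c_{10} + 3 c_{11} - 3 c_{12} + 5 c_{17} + 3 c_{18} + c_{2} - 2 c_{3} + c_{5}}{9} + 3 \beta_1^2 \beta_3 \frac{8 c_{10} + 3 c_{11} - 2 c_{2}}{9} + 6 \beta_1 \beta_2 \beta_3 \frac{3 c_{10} + 6 c_{11} + 3 c_{12} + c_{2} - 4 c_{3} + c_{4} - c_{5}}{9} + \beta_3^3 c_{23},$$ $$\tilde c_{24} = \beta_1^3 \frac{2 c_{4} + c_{5}}{3} + 3 \beta_1^2 \beta_2 \frac{c_{4} + 8 c_{5} - c_{6} + c_{7}}{9} + 3 \beta_1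 \beta_2^2 \frac{3 c_{5} + 8 c_{6} - 2 c_{7}}{9} + \beta_2^3 \frac{2 c_{6} + c_{7}}{3} + 3 \beta_2^2 \beta_3 \frac{3 c_{13} + 8 c_{14} - 2 c_{7}}{9} + 3 \beta_2 \beta_3^2 \frac{-3 c_{12} + 3 c_{13} + c_{14} + 3 c_{19} + 5 c_{20} + c_{4} - 2 c_{6} + c_{7}}{9} + 3 \beta_1 \beta_3^2 \frac{-6 c_{12} + 12 c_{19} + 2 c_{20} + 2 c_{4} - c_{5}}{9} + 3 \beta_1^2 \beta_3 \frac{15 c_{12} + c_{14} - 4 c_{4} - 2 c_{5} - c_{6}}{9} + 6 \beta_1 \beta_2 \beta_3 \frac{3 c_{12} + 6 c_{13} + 3 c_{14} - c_{4} + c_{5} - 4 c_{6} + c_{7}}{9} + \beta_3^3 c_{24},$$ $$\tilde c_{25} = \beta_1^3 c_{5} + 3 \beta_1^2 \beta_2 \frac{5 c_{6} - 2 c_{7}}{3} + 3 \beta_1 \beta_2^2 \frac{4 c_{7} - c_{8}}{3} + \beta_2^3 c_{8} + 3 \beta_2^2 \beta_3 \frac{4 c_{15} - c_{8}}{3} +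 3 \beta_2 \beta_3^2 \frac{5 c_{21} - 2 c_{15}}{3} + 3 \beta_3^2 \beta_1 \frac{c_{14} + 3 c_{20} - c_{21}}{3} + 3 \beta_3 \beta_1^2 \frac{3 c_{13} + c_{14} - c_{6}}{3} + 6 \beta_1 \beta_2 \beta_3 \frac{5 c_{14} - c_{7} - c_{15}}{3} + \beta_3^3 c_{25},$$ $$0 = (3 \beta_1^2 \beta_2 - 3 \beta_1 \beta_2^2) \frac{c_{2} - 2 c_{3} + 2 c_{4} - 2 c_{5} + 2 c_{6} - c_{7}}{3} + 3 \beta_1^2 \beta_3 \frac{c_{11} - 3 c_{12} + c_{13} + c_{2} - 2 c_{3} + 2 c_{4}}{3} + 3 \beta_2^2 \beta_3 \frac{c_{11} - 3 c_{12} + c_{13} + c_{7} - 2 c_{6} + 2 c_{5}}{3} + 3 \beta_1 \beta_3^2 \frac{-5 c_{11} + 6 c_{12} + c_{13} + 9 c_{18} - 9 c_{19} - 2 c_{2} + 4 c_{3} - 4 c_{4}}{6} + 3 \beta_2 \beta_3^2 \frac{-5 c_{13} + 6 c_{12} + c_{11} + 9 c_{19} - 9 c_{18} - 2 c_{7} +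 4 c_{6} - 4 c_{5}}{6} + 6 \beta_1 \beta_2 \beta_3 \frac{-2 c_{11} + 6 c_{12} - 2 c_{13} - c_{2} + 2 c_{3} - 2 c_{4} - 2 c_{5} + 2 c_{6} - c_{7}}{3}.$$ The last relation involves only the coefficients of the spline on $\triangle$. Consequently a $C^3$ join cannot be achieved in general: unless $\tilde v_3=v_1+v_2-v_3$, there are coefficients $c_1,\dots,c_{39}$ such that for no $\tilde c_1,\dots,\tilde c_{39}$ do $f$ and $\tilde f$ meet with $C^3$ smoothness. -/

import Mathlib

open scoped Topology

noncomputable section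

/-- The Euclidean plane. -/
abbrev Plane : Type := EuclideanSpace ℝ (Fin 2)

namespace PS12

/-- Signed area of the triangle with vertices `p`, `q`, `r`. -/
def signedArea (p q r : Plane) : ℝ :=
  ((q 0 - p 0) * (r 1 - p 1) - (r 0 - p 0) * (q 1 - p 1)) / 2

/-- The (closed) triangle with vertices `v 0`, `v 1`, `v 2`. -/
def triangle (v : Fin 3 → Plane) : Set Plane := convexHull ℝ (Set.range v)

/-- The ten vertices `v₁, …, v₁₀` of the Powell-Sabin 12-split of the triangle `v` (here indexed
from `0`): the corners, the midpoints of the edges `v₁v₂`, `v₂v₃`, `v₁v₃`, the midpoints of `v₄v₆`,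
`v₄v₅`, `v₅v₆`, and the barycentre. -/
def vertex (v : Fin 3 → Plane) : Fin 10 → Plane :=
  ![v 0, v 1, v 2,
    midpoint ℝ (v 0) (v 1), midpoint ℝ (v 1) (v 2), midpoint ℝ (v 0) (v 2),
    midpoint ℝ (midpoint ℝ (v 0) (v 1)) (midpoint ℝ (v 0) (v 2)),
    midpoint ℝ (midpoint ℝ (v 0) (v 1)) (midpoint ℝ (v 1) (v 2)),
    midpoint ℝ (midpoint ℝ (v 1) (v 2)) (midpoint ℝ (v 0) (v 2)),
    (1 / 3 : ℝ) • (v 0 + v 1 + v 2)]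

/-- A point in the interior of the triangle that lies on no line through two vertices of the
12-split. -/
def genericPoint (v : Fin 3 → Plane) : Plane :=
  (9 / 14 : ℝ) • v 0 + (4 / 14 : ℝ) • v 1 + (1 / 14 : ℝ) • v 2

/-- The half-open convex hull `[K)`. Every point `x` of the closed macrotriangle is assigned to
exactly one face of the 12-split, namely the face that contains the points near `x` on the segment
from `x` to the generic point; `[K)` consists of the points whose face lies in the convex hull of
`K`. -/
def halfOpenHull (v : Fin 3 → Plane) (K : Set Plane) : Set Plane :=
  {x | ∀ᶠ ε in 𝓝[>] (0 : ℝ), AffineMap.lineMap x (genericPoint v) ε ∈ convexHull ℝ K}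

open Classical in
/-- For a knot multiset given by the multiplicities `m`, the lexicographically first triple of
knots that are not collinear; it is `none` exactly when the convex hull of the knots has
area `0`. -/
def firstTriple (v : Fin 3 → Plane) (m : Fin 10 → ℕ) : Option (Fin 10 × Fin 10 × Fin 10) :=
  (List.finRange 10 ×ˢ (List.finRange 10 ×ˢ List.finRange 10)).find? fun t =>
    decide (0 < m t.1 ∧ 0 < m t.2.1 ∧ 0 < m t.2.2 ∧
      signedArea (vertex v t.1) (vertex v t.2.1) (vertex v t.2.2) ≠ 0)

/-- The recursion for the simplex spline of degree `d` with knot multiset given by the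
multiplicities `m` (with `d + 3` knots). In the recursive step `x` is written as an affine
combination of knots; the value does not depend on which combination is used, and here it is the
one that uses only the three knots of `firstTriple`. -/
def simplexSplineAux (v : Fin 3 → Plane) : ℕ → (Fin 10 → ℕ) → Plane → ℝ
  | 0, m, x =>
    match firstTriple v m with
    | none => 0
    | some (i, j, k) =>
      (halfOpenHull v {vertex v i, vertex v j, vertex v k}).indicator
        (fun _ => |signedArea (v 0) (v 1) (v 2)| /
          |signedArea (vertex v i) (vertex v j) (vertex v k)|) x
  | d + 1, m, x =>
    match firstTriple v m with
    | none => 0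
    | some (i, j, k) =>
      signedArea x (vertex v j) (vertex v k) / signedArea (vertex v i) (vertex v j) (vertex v k) *
          simplexSplineAux v d (m - Pi.single i 1) x +
        signedArea (vertex v i) x (vertex v k) /
            signedArea (vertex v i) (vertex v j) (vertex v k) *
          simplexSplineAux v d (m - Pi.single j 1) x +
        signedArea (vertex v i) (vertex v j) x /
            signedArea (vertex v i) (vertex v j) (vertex v k) *
          simplexSplineAux v d (m - Pi.single k 1) x

/-- The area normalized simplex spline `Q[v₁^{m₁} ⋯ v₁₀^{m₁₀}]` on the 12-split of the
triangle `v`. -/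
def simplexSpline (v : Fin 3 → Plane) (m : Fin 10 → ℕ) (x : Plane) : ℝ :=
  simplexSplineAux v ((∑ i, m i) - 3) m x

/-- The knot multiplicities of the simplex splines `Q₁, …, Q₃₉` of the basis `B_c`, ordered by
increasing number of knots outside the edge `v₁v₂`. -/
def bcKnots : ℕ → Fin 10 → ℕ
  | 1 => ![6, 0, 0, 1, 0, 1, 0, 0, 0, 0]
  | 2 => ![5, 0, 0, 2, 0, 1, 0, 0, 0, 0]
  | 3 => ![4, 1, 0, 2, 0, 1, 0, 0, 0, 0]
  | 4 => ![3, 2, 0, 2, 0, 1, 0, 0, 0, 0]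
  | 5 => ![2, 3, 0, 2, 1, 0, 0, 0, 0, 0]
  | 6 => ![1, 4, 0, 2, 1, 0, 0, 0, 0, 0]
  | 7 => ![0, 5, 0, 2, 1, 0, 0, 0, 0, 0]
  | 8 => ![0, 6, 0, 1, 1, 0, 0, 0, 0, 0]
  | 9 => ![5, 0, 0, 1, 0, 2, 0, 0, 0, 0]
  | 10 => ![4, 1, 1, 1, 0, 1, 0, 0, 0, 0]
  | 11 => ![3, 1, 1, 2, 0, 1, 0, 0, 0, 0]
  | 12 => ![2, 2, 0, 2, 1, 1, 0, 0, 0, 0]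
  | 13 => ![1, 3, 1, 2, 1, 0, 0, 0, 0, 0]
  | 14 => ![1, 4, 1, 1, 1, 0, 0, 0, 0, 0]
  | 15 => ![0, 5, 0, 1, 2, 0, 0, 0, 0, 0]
  | 16 => ![4, 0, 1, 1, 0, 2, 0, 0, 0, 0]
  | 17 => ![3, 1, 1, 1, 0, 2, 0, 0, 0, 0]
  | 18 => ![2, 1, 1, 2, 1, 1, 0, 0, 0, 0]
  | 19 => ![1, 2, 1, 2, 1, 1, 0, 0, 0, 0]
  | 20 => ![1, 3, 1, 1, 2, 0, 0, 0, 0, 0]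
  | 21 => ![0, 4, 1, 1, 2, 0, 0, 0, 0, 0]
  | 22 => ![3, 0, 2, 1, 0, 2, 0, 0, 0, 0]
  | 23 => ![2, 1, 1, 1, 1, 2, 0, 0, 0, 0]
  | 24 => ![1, 2, 1, 1, 2, 1, 0, 0, 0, 0]
  | 25 => ![0, 3, 2, 1, 2, 0, 0, 0, 0, 0]
  | 26 => ![2, 0, 2, 1, 1, 2, 0, 0, 0, 0]
  | 27 => ![1, 1, 2, 1, 2, 1, 0, 0, 0, 0]
  | 28 => ![1, 1, 2, 1, 1, 2, 0, 0, 0, 0]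
  | 29 => ![0, 2, 2, 1, 2, 1, 0, 0, 0, 0]
  | 30 => ![2, 0, 3, 0, 1, 2, 0, 0, 0, 0]
  | 31 => ![1, 1, 4, 0, 1, 1, 0, 0, 0, 0]
  | 32 => ![1, 1, 3, 0, 2, 1, 0, 0, 0, 0]
  | 33 => ![1, 1, 3, 0, 1, 2, 0, 0, 0, 0]
  | 34 => ![0, 2, 3, 0, 2, 1, 0, 0, 0, 0]
  | 35 => ![1, 0, 4, 0, 1, 2, 0, 0, 0, 0]
  | 36 => ![0, 1, 4, 0, 2, 1, 0, 0, 0, 0]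
  | 37 => ![0, 0, 6, 0, 1, 1, 0, 0, 0, 0]
  | 38 => ![0, 0, 5, 0, 2, 1, 0, 0, 0, 0]
  | 39 => ![0, 0, 5, 0, 1, 2, 0, 0, 0, 0]
  | _ => 0

/-- The weights `w₁, …, w₃₉` of the basis `B_c = {wᵢ Qᵢ}`. -/
def bcWeight : ℕ → ℝ
  | 1 | 2 | 7 | 8 | 9 | 15 | 37 | 38 | 39 => 1 / 4
  | 3 | 4 | 5 | 6 | 11 | 13 | 16 | 17 | 20 | 21 | 22 | 25 | 30 | 32 | 33 | 34 | 35 | 36 => 1 / 2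
  | 12 | 18 | 19 | 23 | 24 | 26 | 27 | 28 | 29 => 3 / 4
  | 10 | 14 | 31 => 1
  | _ => 0

/-- The spline `∑ cᵢ wᵢ Qᵢ`, `i = 1, …, 39`, on the triangle `v`. Only the values
`c 1, …, c 39` matter. -/
def bcSpline (v : Fin 3 → Plane) (c : ℕ → ℝ) (x : Plane) : ℝ :=
  ∑ i ∈ Finset.Icc 1 39, c i * bcWeight i * simplexSpline v (bcKnots i) x

open Classical in
/-- The functions `f` on `S` and `g` on `T` meet with `C^r` smoothness along `S ∩ T`: they agree
there, and the function on `S ∪ T` that they make up together is of class `C^r` at every point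
of `S ∩ T`. -/
def MeetsSmoothly (r : ℕ) (S T : Set Plane) (f g : Plane → ℝ) : Prop :=
  Set.EqOn f g (S ∩ T) ∧
    ∀ x ∈ S ∩ T, ContDiffWithinAt ℝ r (S.piecewise f g) (S ∪ T) x

/-- The linear relations for `C^0` smoothness. -/
def C0Relations (c c' : ℕ → ℝ) : Prop := ∀ i ∈ Finset.Icc 1 8, c' i = c i

/-- The additional linear relations for `C^1` smoothness. -/
def C1Relations (β₁ β₂ β₃ : ℝ) (c c' : ℕ → ℝ) : Prop :=
  c' 9 = β₁ * c 1 + β₂ * c 2 + β₃ * c 9 ∧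
  c' 10 = β₁ * c 2 + β₂ * c 3 + β₃ * c 10 ∧
  c' 11 = β₁ * (2 * c 3 - c 2) + β₂ * c 4 + β₃ * c 11 ∧
  c' 12 = β₁ * ((2 * c 4 + c 5) / 3) + β₂ * ((c 4 + 2 * c 5) / 3) + β₃ * c 12 ∧
  c' 13 = β₁ * c 5 + β₂ * (2 * c 6 - c 7) + β₃ * c 13 ∧
  c' 14 = β₁ * c 6 + β₂ * c 7 + β₃ * c 14 ∧
  c' 15 = β₁ * c 7 + β₂ * c 8 + β₃ * c 15

/-- The additional linear relations for `C^2` smoothness. -/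
def C2Relations (β₁ β₂ β₃ : ℝ) (c c' : ℕ → ℝ) : Prop :=
  c' 16 = β₁ ^ 2 * c 1 + 2 * β₁ * β₂ * c 2 + β₂ ^ 2 * c 3 + 2 * β₁ * β₃ * c 9 + 2 * β₂ * β₃ * c 10
      + β₃ ^ 2 * c 16 ∧
  c' 17 = β₁ ^ 2 * c 2 + β₂ ^ 2 * c 4 + β₃ ^ 2 * c 17 + 2 * β₁ * β₂ * ((3 * c 3 - c 2) / 2)
      + 2 * β₁ * β₃ * ((3 * c 10 - c 2) / 2)
      + 2 * β₂ * β₃ * ((c 10 + 2 * c 11 - c 3) / 2) ∧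
  c' 18 = β₁ ^ 2 * ((2 * c 3 + 2 * c 4 - c 2) / 3) + β₂ ^ 2 * ((c 4 + 2 * c 5) / 3)
      + β₃ ^ 2 * c 18 + 2 * β₁ * β₂ * ((c 2 - 2 * c 3 + 6 * c 4 + c 5) / 6)
      + 2 * β₁ * β₃ * ((c 2 - 2 * c 3 + 2 * c 4 - c 5 + 3 * c 11 + 3 * c 12) / 6)
      + 2 * β₂ * β₃ * ((9 * c 12 - 2 * c 5 - c 11) / 6) ∧
  c' 19 = β₁ ^ 2 * ((2 * c 4 + c 5) / 3) + β₂ ^ 2 * ((2 * c 5 + 2 * c 6 - c 7) / 3)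
      + β₃ ^ 2 * c 19 + 2 * β₁ * β₂ * ((c 4 + 6 * c 5 - 2 * c 6 + c 7) / 6)
      + 2 * β₂ * β₃ * ((c 7 - 2 * c 6 + 2 * c 5 - c 4 + 3 * c 13 + 3 * c 12) / 6)
      + 2 * β₁ * β₃ * ((9 * c 12 - 2 * c 4 - c 13) / 6) ∧
  c' 20 = β₁ ^ 2 * c 5 + β₂ ^ 2 * c 7 + β₃ ^ 2 * c 20 + 2 * β₁ * β₂ * ((3 * c 6 - c 7) / 2)
      + 2 * β₁ * β₃ * ((c 14 + 2 * c 13 - c 6) / 2)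
      + 2 * β₂ * β₃ * ((3 * c 14 - c 7) / 2) ∧
  c' 21 = β₁ ^ 2 * c 6 + 2 * β₁ * β₂ * c 7 + β₂ ^ 2 * c 8 + 2 * β₁ * β₃ * c 14
      + 2 * β₂ * β₃ * c 15 + β₃ ^ 2 * c 21

/-- The additional linear relations for `C^3` smoothness that involve both triangles. -/
def C3Relations (β₁ β₂ β₃ : ℝ) (c c' : ℕ → ℝ) : Prop :=
  c' 22 = β₁ ^ 3 * c 1 + 3 * β₁ ^ 2 * β₂ * ((4 * c 2 - c 1) / 3)
      + 3 * β₁ * β₂ ^ 2 * ((5 * c 3 - 2 * c 2) / 3) + β₂ ^ 3 * c 4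
      + 3 * β₂ ^ 2 * β₃ * ((c 10 - c 3 + 3 * c 11) / 3)
      + 3 * β₂ * β₃ ^ 2 * ((c 10 - c 16 + 3 * c 17) / 3) + β₃ ^ 3 * c 22
      + 3 * β₃ ^ 2 * β₁ * ((5 * c 16 - 2 * c 9) / 3)
      + 3 * β₃ * β₁ ^ 2 * ((4 * c 9 - c 1) / 3)
      + 6 * β₁ * β₂ * β₃ * ((5 * c 10 - c 2 - c 9) / 3) ∧
  c' 23 = β₁ ^ 3 * ((c 2 + 2 * c 3) / 3) + 3 * β₁ ^ 2 * β₂ * ((-2 * c 2 + 8 * c 3 + 3 * c 4) / 9)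
      + 3 * β₁ * β₂ ^ 2 * ((c 2 - c 3 + 8 * c 4 + c 5) / 9)
      + β₂ ^ 3 * ((c 4 + 2 * c 5) / 3)
      + 3 * β₂ ^ 2 * β₃ * ((c 10 + 15 * c 12 - c 3 - 2 * c 4 - 4 * c 5) / 9)
      + 3 * β₂ * β₃ ^ 2 * ((-6 * c 12 + 2 * c 17 + 12 * c 18 - c 4 + 2 * c 5) / 9)
      + 3 * β₁ * β₃ ^ 2 * ((c 10 + 3 * c 11 - 3 * c 12 + 5 * c 17 + 3 * c 18 + c 2 - 2 * c 3 + c 5) / 9)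
      + 3 * β₁ ^ 2 * β₃ * ((8 * c 10 + 3 * c 11 - 2 * c 2) / 9)
      + 6 * β₁ * β₂ * β₃ * ((3 * c 10 + 6 * c 11 + 3 * c 12 + c 2 - 4 * c 3 + c 4 - c 5) / 9)
      + β₃ ^ 3 * c 23 ∧
  c' 24 = β₁ ^ 3 * ((2 * c 4 + c 5) / 3) + 3 * β₁ ^ 2 * β₂ * ((c 4 + 8 * c 5 - c 6 + c 7) / 9)
      + 3 * β₁ * β₂ ^ 2 * ((3 * c 5 + 8 * c 6 - 2 * c 7) / 9)
      + β₂ ^ 3 * ((2 * c 6 + c 7) / 3)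
      + 3 * β₂ ^ 2 * β₃ * ((3 * c 13 + 8 * c 14 - 2 * c 7) / 9)
      + 3 * β₂ * β₃ ^ 2 * ((-3 * c 12 + 3 * c 13 + c 14 + 3 * c 19 + 5 * c 20 + c 4 - 2 * c 6 + c 7) / 9)
      + 3 * β₁ * β₃ ^ 2 * ((-6 * c 12 + 12 * c 19 + 2 * c 20 + 2 * c 4 - c 5) / 9)
      + 3 * β₁ ^ 2 * β₃ * ((15 * c 12 + c 14 - 4 * c 4 - 2 * c 5 - c 6) / 9)
      + 6 * β₁ * β₂ * β₃ * ((3 * c 12 + 6 * c 13 + 3 * c 14 - c 4 + c 5 - 4 * c 6 + c 7) / 9)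
      + β₃ ^ 3 * c 24 ∧
  c' 25 = β₁ ^ 3 * c 5 + 3 * β₁ ^ 2 * β₂ * ((5 * c 6 - 2 * c 7) / 3)
      + 3 * β₁ * β₂ ^ 2 * ((4 * c 7 - c 8) / 3) + β₂ ^ 3 * c 8
      + 3 * β₂ ^ 2 * β₃ * ((4 * c 15 - c 8) / 3)
      + 3 * β₂ * β₃ ^ 2 * ((5 * c 21 - 2 * c 15) / 3)
      + 3 * β₃ ^ 2 * β₁ * ((c 14 + 3 * c 20 - c 21) / 3)
      + 3 * β₃ * β₁ ^ 2 * ((3 * c 13 + c 14 - c 6) / 3)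
      + 6 * β₁ * β₂ * β₃ * ((5 * c 14 - c 7 - c 15) / 3) + β₃ ^ 3 * c 25

/-- The additional linear relation for `C^3` smoothness that involves the coefficients of one
triangle only. -/
def C3Compatibility (β₁ β₂ β₃ : ℝ) (c : ℕ → ℝ) : Prop :=
  0 =
      (3 * β₁ ^ 2 * β₂ - 3 * β₁ * β₂ ^ 2) * ((c 2 - 2 * c 3 + 2 * c 4 - 2 * c 5 + 2 * c 6 - c 7) / 3)
      + 3 * β₁ ^ 2 * β₃ * ((c 11 - 3 * c 12 + c 13 + c 2 - 2 * c 3 + 2 * c 4) / 3)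
      + 3 * β₂ ^ 2 * β₃ * ((c 11 - 3 * c 12 + c 13 + c 7 - 2 * c 6 + 2 * c 5) / 3)
      + 3 * β₁ * β₃ ^ 2 * ((-5 * c 11 + 6 * c 12 + c 13 + 9 * c 18 - 9 * c 19 - 2 * c 2 + 4 * c 3 - 4 * c 4) / 6)
      + 3 * β₂ * β₃ ^ 2 * ((-5 * c 13 + 6 * c 12 + c 11 + 9 * c 19 - 9 * c 18 - 2 * c 7 + 4 * c 6 - 4 * c 5) / 6)
      + 6 * β₁ * β₂ * β₃ * ((-2 * c 11 + 6 * c 12 - 2 * c 13 - c 2 + 2 * c 3 - 2 * c 4 - 2 * c 5 + 2 * c 6 - c 7) / 3)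

end PS12

end

/-!
In the barycentric coordinates `s = λ₂`, `t = λ₃` of `△`, a spline with knots at `v₁, …, v₆` is a
polynomial on each of the twelve faces, and the recursion for it becomes a recursion for polynomials
with integer coefficients that depends on the face but not on the triangle (`simplexSplineAux_eq`).
So everything that is needed about `Q₁, …, Q₃₉` follows from finitely many integer computations,
which `decide +kernel` carries out. There are two of them.

* `crossCutPoly_check`: let `P` be the polynomial of `Q_i` on the face `[v₁, v₄, v₇]`. On every other
  face, `Q_i` is `P` plus a sum of terms `q_L L ^ 4`, one for each interior line `L = 0` of the
  12-split that separates the two faces, with the same linear polynomials `q_L` for all faces. Hence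
  `P + ∑ q_L max(L, 0) ^ 4` is a function of class `C^3` on the whole plane that extends `Q_i`
  (`bcSpline_eq`, `contDiff_splineExt`).
* `edgeTable_check`: the coefficients of `s ^ j t ^ k`, `k ≤ 3`, of the `w_i Q_i` on the two faces
  with a side on the edge `e = [v₁, v₂]`.

The map from the coordinates of `△̃` to those of `△` is `(s, t) ↦ (s + β₂ t, β₃ t)`, and `β₃ < 0`
because the triangles lie on opposite sides of `e`. For `r ≤ 3`, the splines meet with `C^r`
smoothness if and only if, on each of the two faces along `e`, the polynomial of `f̃` and the
polynomial of `f` after this substitution have the same coefficients of `t ^ 0, …, t ^ r`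
(`AdjacentTriangles.meetsSmoothly_iff`). Necessity is seen on lines across `e`, where the two
polynomials continue each other to a function of class `C^r` at `0`. For sufficiency, the difference
of the two `C^3` extensions is locally a multiple of `t ^ (r + 1)`, so their derivatives up to order
`r` agree along `e` (at the end points and the midpoint of `e` by continuity), and two smooth
functions whose derivatives agree on the intersection of two closed sets make up a smooth function on
the union (`contDiffOn_piecewise`).

What remains is linear algebra. Once the relations of lower order hold, the equations for the
coefficients of `t ^ k` on the two faces determine `8`, `7`, `6`, `4` of the numbers `c̃_i` for
`k = 0, 1, 2, 3`; these are the relations (`edgeEq_zero_iff`, …, `edgeEq_three_iff`). For `k = 3` there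
is one more independent equation, from which the `c̃_i` can be eliminated; it is the condition on the
coefficients of `f` alone. It fails for `f = w₁₈ Q₁₈` if `β₁ ≠ β₂`, and for `f = w₁₁ Q₁₁` if
`β₁ = β₂ ≠ 1`.
-/

set_option maxRecDepth 100000

noncomputable section

namespace PS12

open Polynomial

/-! ### Integer polynomials in two variables and the recursion on a face -/

/-- A polynomial in `s` and `t` with integer coefficients: entry `j` of row `k` is the coefficient
of `s ^ j * t ^ k`. The operations below are written for evaluation in the kernel. -/
abbrev IntPoly : Type := List (List ℤ)

/-- Three integers: barycentric coordinates up to a common factor, or the coefficients of a linear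
form in the barycentric coordinates. -/
abbrev Triple : Type := ℤ × ℤ × ℤ

def rowAdd : List ℤ → List ℤ → List ℤ
  | [], b => b
  | x :: a, [] => x :: a
  | x :: a, y :: b => Int.add x y :: rowAdd a b

def polyAdd : IntPoly → IntPoly → IntPoly
  | [], b => b
  | x :: a, [] => x :: a
  | x :: a, y :: b => rowAdd x y :: polyAdd a b

def rowScale (c : ℤ) : List ℤ → List ℤ
  | [] => []
  | x :: r => Int.mul c x :: rowScale c r

def intIsZero : ℤ → Bool
  | .ofNat n => Nat.beq n 0
  | .negSucc _ => false

/-- The product of a polynomial in `s` with `a + b s`. -/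
def rowMulLinear (a b : ℤ) (r : List ℤ) : List ℤ :=
  bif intIsZero a then (bif intIsZero b then [] else 0 :: rowScale b r)
  else bif intIsZero b then rowScale a r else rowAdd (rowScale a r) (0 :: rowScale b r)

/-- The product of a polynomial with `a + b s + c t`. -/
def polyMulLinear (a b c : ℤ) (p : IntPoly) : IntPoly :=
  bif p.isEmpty then [] else
    polyAdd (p.map (rowMulLinear a b)) (bif intIsZero c then [] else [] :: p.map (rowScale c))

/-- The product of a polynomial with the linear form `c` in the barycentric coordinates
`(1 - s - t, s, t)`. -/
def polyMulForm (c : Triple) : IntPoly → IntPoly := polyMulLinear c.1 (c.2.1 - c.1) (c.2.2 - c.1)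

/-- Whether all listed coefficients vanish. -/
def polyIsZero (p : IntPoly) : Bool := p.all (·.all intIsZero)

/-- The coefficient of `s ^ j * t ^ k`. -/
def coef (p : IntPoly) (k j : ℕ) : ℤ := (p.getD k []).getD j 0

/-- Twice the barycentric coordinates of the knots `v₁, …, v₆` (indexed from `0`). -/
def knotBary : ℕ → Triple
  | 0 => (2, 0, 0)
  | 1 => (0, 2, 0)
  | 2 => (0, 0, 2)
  | 3 => (1, 1, 0)
  | 4 => (0, 1, 1)
  | 5 => (1, 0, 1)
  | _ => (0, 0, 0)

/-- The cross product, whose components are the coefficients of the linear form `det(·, q, r)`. -/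
def cross (q r : Triple) : Triple :=
  (q.2.1 * r.2.2 - q.2.2 * r.2.1, q.2.2 * r.1 - q.1 * r.2.2, q.1 * r.2.1 - q.2.1 * r.1)

/-- The value of the linear form `q` at the point `p`. -/
def dot (p q : Triple) : ℤ := p.1 * q.1 + p.2.1 * q.2.1 + p.2.2 * q.2.2

/-- The determinant of three coordinate triples. -/
def det3 (p q r : Triple) : ℤ := dot p (cross q r)

/-- The increasing triples of noncollinear knots among `v₁, …, v₆`. -/
def knotTriples : List (ℕ × ℕ × ℕ) :=
  (List.range 6 ×ˢ (List.range 6 ×ˢ List.range 6)).filter fun t =>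
    t.1 < t.2.1 && t.2.1 < t.2.2 && det3 (knotBary t.1) (knotBary t.2.1) (knotBary t.2.2) != 0

/-- Hexadecimal digit `i` of `K`. A knot multiset on `v₁, …, v₆` is encoded by the number whose
digits are the multiplicities. -/
def digit (K i : ℕ) : ℕ := Nat.land (Nat.shiftRight K (Nat.mul 4 i)) 15

/-- The lexicographically first noncollinear triple of knots of the encoded multiset `K`. -/
def firstCode (K : ℕ) : Option (ℕ × ℕ × ℕ) :=
  knotTriples.find? fun t =>
    Nat.ble 1 (digit K t.1) && (Nat.ble 1 (digit K t.2.1) && Nat.ble 1 (digit K t.2.2))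

/-- Coefficients of the linear form `2 det(·, q, r) / D`. For the knots `v₁, …, v₆` the division is
exact. -/
def baryForm (q r : Triple) (D : ℤ) : Triple :=
  (2 * (cross q r).1 / D, 2 * (cross q r).2.1 / D, 2 * (cross q r).2.2 / D)

/-- The constant value of a spline of degree `0` on the face that contains the interior
point `f`. -/
def leafPoly (f : Triple) (K : ℕ) : IntPoly :=
  match firstCode K with
  | none => []
  | some (i, j, k) =>
    let p := knotBary i
    let q := knotBary j
    let r := knotBary k
    let D := det3 p q r
    if 0 < D * dot f (cross q r) ∧ 0 < D * dot f (cross r p) ∧ 0 < D * dot f (cross p q) then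
      [[8 / |D|]] else []

/-- One step of the recursion for the splines, applied to polynomials on a face. -/
def stepPoly (g : ℕ → IntPoly) (K : ℕ) : IntPoly :=
  match firstCode K with
  | none => []
  | some (i, j, k) =>
    let p := knotBary i
    let q := knotBary j
    let r := knotBary k
    let D := det3 p q r
    polyAdd (polyMulForm (baryForm q r D) (g (K - 16 ^ i)))
      (polyAdd (polyMulForm (baryForm r p D) (g (K - 16 ^ j)))
        (polyMulForm (baryForm p q D) (g (K - 16 ^ k))))

/-- The polynomial that the spline of degree `d` with knots `K` equals on the face containing the
interior point `f`, in the barycentric coordinates `s = λ₂`, `t = λ₃`. -/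
def facePoly (f : Triple) : ℕ → ℕ → IntPoly
  | 0 => leafPoly f
  | d + 1 => stepPoly (facePoly f d)

/-! ### Memoised evaluation -/

/-- The entry of a table at `K`, with the default value `e`. -/
def lookupD : List (ℕ × IntPoly) → ℕ → IntPoly → IntPoly
  | [], _, e => e
  | a :: l, K, e => bif Nat.beq a.1 K then a.2 else lookupD l K e

/-- The function `g`, with its values on `L` taken from a table. The table is a closed term whose
entries the kernel evaluates once. -/
def memoize (L : List ℕ) (g : ℕ → IntPoly) (K : ℕ) : IntPoly :=
  lookupD (L.map fun K => (K, g K)) K (g K)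

/-- The knot multisets to which one step of the recursion reduces `K`. -/
def children (K : ℕ) : List ℕ :=
  match firstCode K with
  | none => []
  | some (i, j, k) => [K - 16 ^ i, K - 16 ^ j, K - 16 ^ k]

/-- The elements of the second list that are not in the accumulator, without repetitions, put in
front of it. -/
def dedupInto : List ℕ → List ℕ → List ℕ
  | acc, [] => acc
  | acc, k :: l => bif acc.any (Nat.beq k) then dedupInto acc l else dedupInto (k :: acc) l

/-- The code of the knot multiset of `Q_i`. -/
def bcCode (i : ℕ) : ℕ :=
  bcKnots i 0 + bcKnots i 1 * 16 + bcKnots i 2 * 16 ^ 2 + bcKnots i 3 * 16 ^ 3 +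
    bcKnots i 4 * 16 ^ 4 + bcKnots i 5 * 16 ^ 5

/-- The knot multisets that occur at depth `n` of the recursion for `Q₁, …, Q₃₉`. -/
def codesAtDepth : ℕ → List ℕ
  | 0 => (List.range' 1 39).map bcCode
  | n + 1 => dedupInto [] ((codesAtDepth n).flatMap children)

/-- A copy of `facePoly` with tabulated intermediate results. -/
def memoPoly (f : Triple) : ℕ → ℕ → IntPoly
  | 0 => memoize (codesAtDepth 5) (leafPoly f)
  | d + 1 => memoize (codesAtDepth (4 - d)) (stepPoly (memoPoly f d))

theorem lookupD_map (L : List ℕ) (g : ℕ → IntPoly) (K : ℕ) :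
    lookupD (L.map fun K => (K, g K)) K (g K) = g K := by
  induction L with
  | nil => rfl
  | cons a L ih =>
    rw [List.map_cons, lookupD]
    cases h : Nat.beq a K with
    | false => simpa using ih
    | true => simp [Nat.eq_of_beq_eq_true h]

theorem memoPoly_eq (f : Triple) (d : ℕ) : memoPoly f d = facePoly f d := by
  induction d with
  | zero => funext K; exact lookupD_map _ _ K
  | succ d ih => funext K; rw [memoPoly, ih]; exact lookupD_map _ _ K

/-! ### Cross-cut representation -/

/-- Interior points of the twelve faces of the 12-split, in barycentric coordinates up to a common
factor. -/
def faces : List Triple :=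
  [(45, 35, 20), (45, 20, 35), (35, 45, 20), (20, 45, 35), (35, 20, 45), (20, 35, 45),
   (60, 25, 15), (60, 15, 25), (25, 60, 15), (15, 60, 25), (25, 15, 60), (15, 25, 60)]

/-- The face with vertices `v₁, v₄, v₇`. -/
def faceA : Triple := (60, 25, 15)

/-- The face with vertices `v₂, v₄, v₈`. -/
def faceB : Triple := (25, 60, 15)

/-- The linear forms vanishing on the six interior lines of the 12-split (the medians from
`v₁, v₂, v₃` and the three lines through midpoints), negative on `faceA`. -/
def cutForm : ℕ → Triple
  | 0 => (0, -1, 1)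
  | 1 => (-1, 0, 1)
  | 2 => (-1, 1, 0)
  | 3 => (-1, 1, 1)
  | 4 => (-1, 1, -1)
  | _ => (-1, -1, 1)

/-- A pair of adjacent faces separated by the interior line `k`. -/
def cutFaces : ℕ → Triple × Triple
  | 0 => ((60, 25, 15), (60, 15, 25))
  | 1 => ((25, 60, 15), (15, 60, 25))
  | 2 => ((25, 15, 60), (15, 25, 60))
  | 3 => ((60, 25, 15), (45, 35, 20))
  | 4 => ((35, 45, 20), (25, 60, 15))
  | _ => ((35, 20, 45), (25, 15, 60))

/-- The linear factor that remains when the jump of a spline across the interior line `k` is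
divided by the fourth power of `cutForm k`. It is read off from the coefficients of lowest order
(of highest order for the line `s = t`). -/
def cutQuotient (k K : ℕ) : IntPoly :=
  let J := polyAdd (memoPoly (cutFaces k).2 5 K)
    ((memoPoly (cutFaces k).1 5 K).map (rowScale (-1)))
  match k with
  | 0 => [[coef J 4 0, coef J 0 5], [coef J 5 0]]
  | k + 1 =>
    let c := cutForm (k + 1)
    let a := coef J 0 0
    [[a, coef J 0 1 + 4 * (c.2.1 - c.1) * a], [coef J 1 0 + 4 * (c.2.2 - c.1) * a]]

/-- The jump across the interior line `k`. -/
def cutTerm (k K : ℕ) : IntPoly :=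
  let m := polyMulForm (cutForm k)
  m (m (m (m (cutQuotient k K))))

/-- The polynomial on `faceA`, plus the jumps across the interior lines that separate `f` from
`faceA`. -/
def crossCutPoly (f : Triple) (K : ℕ) : IntPoly :=
  (List.range 6).foldr
    (fun k p => bif decide (0 < dot f (cutForm k)) then polyAdd (cutTerm k K) p else p)
    (memoPoly faceA 5 K)

set_option maxHeartbeats 0 in
/-- On every face, each `Q_i` is its polynomial on `faceA` plus linear multiples of fourth powers of
the forms of those interior lines that separate the two faces. -/
theorem crossCutPoly_check :
    ∀ f ∈ faces, ∀ i ∈ List.range' 1 39,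
      polyIsZero (polyAdd (memoPoly f 5 (bcCode i))
        ((crossCutPoly f (bcCode i)).map (rowScale (-1)))) = true := by
  decide +kernel

/-! ### Coefficients next to the common edge -/

/-- Four times the weight of `Q_i`. -/
def weight4 : ℕ → ℤ
  | 1 | 2 | 7 | 8 | 9 | 15 | 37 | 38 | 39 => 1
  | 3 | 4 | 5 | 6 | 11 | 13 | 16 | 17 | 20 | 21 | 22 | 25 | 30 | 32 | 33 | 34 | 35 | 36 => 2
  | 12 | 18 | 19 | 23 | 24 | 26 | 27 | 28 | 29 => 3
  | 10 | 14 | 31 => 4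
  | _ => 0

/-- The nonzero ones among the coefficients of `s ^ j * t ^ k` of the splines `4 wᵢ Qᵢ` on the
face `f`, with their indices. -/
def edgeColumn (f : Triple) (k j : ℕ) : List (ℕ × ℤ) :=
  (List.range' 1 39).filterMap fun i =>
    let a := coef (memoPoly f 5 (bcCode i)) k j
    bif intIsZero a then none else some (i, weight4 i * a)

/-! ### Integer polynomials as polynomials -/

/-- The polynomial with the coefficients in a list, in increasing order. -/
def rowPoly : List ℤ → ℝ[X]
  | [] => 0
  | x :: r => C (x : ℝ) + X * rowPoly r

/-- The element of `ℝ[s][t]` with the coefficients listed in an `IntPoly`. -/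
def toPoly : IntPoly → ℝ[X][X]
  | [] => 0
  | r :: p => C (rowPoly r) + X * toPoly p

theorem intIsZero_eq_true {a : ℤ} : intIsZero a = true ↔ a = 0 := by
  cases a with
  | ofNat n => simp [intIsZero]
  | negSucc n => simp [intIsZero]

theorem rowPoly_rowAdd (a b : List ℤ) : rowPoly (rowAdd a b) = rowPoly a + rowPoly b := by
  induction a generalizing b with
  | nil => simp [rowAdd, rowPoly]
  | cons x a ih =>
    cases b with
    | nil => simp [rowAdd, rowPoly]
    | cons y b =>
      have : ((Int.add x y : ℤ) : ℝ) = x + y := Int.cast_add x y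
      simp only [rowAdd, rowPoly, ih, this, C_add]
      ring

theorem toPoly_polyAdd (a b : IntPoly) : toPoly (polyAdd a b) = toPoly a + toPoly b := by
  induction a generalizing b with
  | nil => simp [polyAdd, toPoly]
  | cons x a ih =>
    cases b with
    | nil => simp [polyAdd, toPoly]
    | cons y b =>
      simp only [polyAdd, toPoly, ih, rowPoly_rowAdd, C_add]
      ring

theorem rowPoly_rowScale (c : ℤ) (r : List ℤ) : rowPoly (rowScale c r) = C (c : ℝ) * rowPoly r := by
  induction r with
  | nil => simp [rowScale, rowPoly]
  | cons x r ih =>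
    have : ((Int.mul c x : ℤ) : ℝ) = c * x := Int.cast_mul c x
    simp only [rowScale, rowPoly, ih, this, C_mul]
    ring

theorem toPoly_map_rowScale (c : ℤ) (p : IntPoly) :
    toPoly (p.map (rowScale c)) = C (C (c : ℝ)) * toPoly p := by
  induction p with
  | nil => simp [toPoly]
  | cons r p ih =>
    simp only [List.map_cons, toPoly, ih, rowPoly_rowScale, C_mul]
    ring

theorem rowPoly_rowMulLinear (a b : ℤ) (r : List ℤ) :
    rowPoly (rowMulLinear a b r) = (C (a : ℝ) + C (b : ℝ) * X) * rowPoly r := by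
  unfold rowMulLinear
  cases ha : intIsZero a <;> cases hb : intIsZero b <;>
    try simp only [intIsZero_eq_true] at ha hb
  all_goals
    simp only [cond_true, cond_false, rowPoly, rowPoly_rowAdd, rowPoly_rowScale, ha, hb,
      Int.cast_zero, C_0]
    ring

theorem toPoly_polyMulLinear (a b c : ℤ) (p : IntPoly) :
    toPoly (polyMulLinear a b c p) =
      (C (C (a : ℝ) + C (b : ℝ) * X) + C (C (c : ℝ)) * X) * toPoly p := by
  have h : ∀ p : IntPoly, toPoly (p.map (rowMulLinear a b)) =
      C (C (a : ℝ) + C (b : ℝ) * X) * toPoly p := by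
    intro p
    induction p with
    | nil => simp [toPoly]
    | cons r p ih =>
      simp only [List.map_cons, toPoly, ih, rowPoly_rowMulLinear, C_mul]
      ring
  unfold polyMulLinear
  cases hp : p.isEmpty with
  | true => simp [List.isEmpty_iff.mp hp, toPoly]
  | false =>
    cases hc : intIsZero c with
    | true =>
      rw [intIsZero_eq_true] at hc
      simp [toPoly_polyAdd, h, toPoly, hc]
    | false =>
      simp only [cond_false, toPoly_polyAdd, h, toPoly, toPoly_map_rowScale, rowPoly]
      simp only [C_0]
      ring

/-- The value of the linear form `c` at the point with barycentric coordinates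
`(1 - s - t, s, t)`. -/
def formEval (c : Triple) (s t : ℝ) : ℝ := c.1 * (1 - s - t) + c.2.1 * s + c.2.2 * t

theorem evalEval_polyMulForm (c : Triple) (p : IntPoly) (s t : ℝ) :
    (toPoly (polyMulForm c p)).evalEval s t = formEval c s t * (toPoly p).evalEval s t := by
  simp only [polyMulForm, toPoly_polyMulLinear, evalEval_mul, evalEval_add, evalEval_C, evalEval_X,
    eval_add, eval_mul, eval_C, eval_X, formEval, Int.cast_sub]
  ring

theorem toPoly_eq_zero {p : IntPoly} (h : polyIsZero p = true) : toPoly p = 0 := by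
  have hrow : ∀ r : List ℤ, r.all intIsZero = true → rowPoly r = 0 := by
    intro r
    induction r with
    | nil => simp [rowPoly]
    | cons x r ih =>
      intro hr
      simp only [List.all_cons, Bool.and_eq_true, intIsZero_eq_true] at hr
      simp [rowPoly, hr.1, ih hr.2]
  induction p with
  | nil => rfl
  | cons r p ih =>
    simp only [polyIsZero, List.all_cons, Bool.and_eq_true] at h
    simp [toPoly, hrow r h.1, ih h.2]

theorem toPoly_eq_of_polyIsZero {p q : IntPoly}
    (h : polyIsZero (polyAdd p (q.map (rowScale (-1)))) = true) : toPoly p = toPoly q := by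
  have h := toPoly_eq_zero h
  rw [toPoly_polyAdd, toPoly_map_rowScale] at h
  simp only [Int.cast_neg, Int.cast_one, C_neg, C_1] at h
  linear_combination h

theorem coeff_rowPoly (r : List ℤ) (j : ℕ) : (rowPoly r).coeff j = (r.getD j 0 : ℤ) := by
  induction r generalizing j with
  | nil => simp [rowPoly]
  | cons x r ih =>
    cases j with
    | zero => simp [rowPoly]
    | succ j =>
      rw [rowPoly, coeff_add, coeff_C_succ, coeff_X_mul, ih, zero_add, List.getD_cons_succ]

theorem coeff_toPoly (p : IntPoly) (k j : ℕ) : ((toPoly p).coeff k).coeff j = coef p k j := by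
  have h : (toPoly p).coeff k = rowPoly (p.getD k []) := by
    induction p generalizing k with
    | nil => simp [toPoly, rowPoly]
    | cons r p ih =>
      cases k with
      | zero => simp [toPoly]
      | succ k => simp [toPoly, ih]
  rw [h, coeff_rowPoly]
  rfl

/-! ### Barycentric coordinates -/

/-- The point `x` has barycentric coordinates `a`, `b`, `c` with respect to the triangle `v`. -/
def IsBary (v : Fin 3 → Plane) (x : Plane) (a b c : ℝ) : Prop :=
  a + b + c = 1 ∧ ∀ e, x e = a * v 0 e + b * v 1 e + c * v 2 e

theorem signedArea_of_isBary {v : Fin 3 → Plane} {x y z : Plane} {x₁ x₂ x₃ y₁ y₂ y₃ z₁ z₂ z₃ : ℝ}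
    (hx : IsBary v x x₁ x₂ x₃) (hy : IsBary v y y₁ y₂ y₃) (hz : IsBary v z z₁ z₂ z₃) :
    signedArea x y z = (x₁ * (y₂ * z₃ - y₃ * z₂) + x₂ * (y₃ * z₁ - y₁ * z₃)
      + x₃ * (y₁ * z₂ - y₂ * z₁)) * signedArea (v 0) (v 1) (v 2) := by
  obtain ⟨hx, hx'⟩ := hx
  obtain ⟨hy, hy'⟩ := hy
  obtain ⟨hz, hz'⟩ := hz
  obtain rfl : x₁ = 1 - x₂ - x₃ := by linarith
  obtain rfl : y₁ = 1 - y₂ - y₃ := by linarith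
  obtain rfl : z₁ = 1 - z₂ - z₃ := by linarith
  simp only [signedArea, hx', hy', hz']
  ring

/-- The second barycentric coordinate of `x` with respect to `v`. -/
def coordS (v : Fin 3 → Plane) (x : Plane) : ℝ :=
  signedArea (v 0) x (v 2) / signedArea (v 0) (v 1) (v 2)

/-- The third barycentric coordinate of `x` with respect to `v`. -/
def coordT (v : Fin 3 → Plane) (x : Plane) : ℝ :=
  signedArea (v 0) (v 1) x / signedArea (v 0) (v 1) (v 2)

theorem isBary_coord {v : Fin 3 → Plane} (hv : signedArea (v 0) (v 1) (v 2) ≠ 0) (x : Plane) :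
    IsBary v x (1 - coordS v x - coordT v x) (coordS v x) (coordT v x) := by
  refine ⟨by ring, fun e => ?_⟩
  unfold coordS coordT
  field_simp
  unfold signedArea
  fin_cases e <;> simp <;> ring

theorem IsBary.coordS_eq {v : Fin 3 → Plane} (hv : signedArea (v 0) (v 1) (v 2) ≠ 0) {x : Plane}
    {a b c : ℝ} (h : IsBary v x a b c) : coordS v x = b := by
  have h0 : IsBary v (v 0) 1 0 0 := ⟨by norm_num, by simp⟩
  have h2 : IsBary v (v 2) 0 0 1 := ⟨by norm_num, by simp⟩
  rw [coordS, signedArea_of_isBary h0 h h2]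
  field_simp
  ring

theorem IsBary.coordT_eq {v : Fin 3 → Plane} (hv : signedArea (v 0) (v 1) (v 2) ≠ 0) {x : Plane}
    {a b c : ℝ} (h : IsBary v x a b c) : coordT v x = c := by
  have h0 : IsBary v (v 0) 1 0 0 := ⟨by norm_num, by simp⟩
  have h1 : IsBary v (v 1) 0 1 0 := ⟨by norm_num, by simp⟩
  rw [coordT, signedArea_of_isBary h0 h1 h]
  field_simp
  ring

theorem isBary_vertex (v : Fin 3 → Plane) {i : ℕ} (hi : i < 6) :
    IsBary v (vertex v (Fin.ofNat 10 i)) ((knotBary i).1 / 2) ((knotBary i).2.1 / 2)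
      ((knotBary i).2.2 / 2) := by
  interval_cases i <;>
    refine ⟨by norm_num [knotBary], fun e => ?_⟩ <;>
    simp [vertex, knotBary, midpoint_eq_smul_add, Fin.ofNat]

theorem mem_convexHull_triple {p q r : Plane} (hD : signedArea p q r ≠ 0) (x : Plane) :
    x ∈ convexHull ℝ {p, q, r} ↔ 0 ≤ signedArea x q r / signedArea p q r ∧
      0 ≤ signedArea p x r / signedArea p q r ∧ 0 ≤ signedArea p q x / signedArea p q r := by
  have hsum : signedArea x q r / signedArea p q r =
      1 - signedArea p x r / signedArea p q r - signedArea p q x / signedArea p q r := by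
    field_simp
    simp only [signedArea]
    ring
  have hb := isBary_coord (v := ![p, q, r]) (by simpa using hD) x
  simp only [coordS, coordT, Matrix.cons_val] at hb
  constructor
  · intro hx
    have hconv : Convex ℝ {y : Plane | 0 ≤ signedArea y q r / signedArea p q r ∧
        0 ≤ signedArea p y r / signedArea p q r ∧ 0 ≤ signedArea p q y / signedArea p q r} := by
      rintro y ⟨hy₁, hy₂, hy₃⟩ z ⟨hz₁, hz₂, hz₃⟩ a b ha hb hab
      obtain rfl : a = 1 - b := by linarith
      refine ⟨?_, ?_, ?_⟩
      · have e : signedArea ((1 - b) • y + b • z) q r =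
            (1 - b) * signedArea y q r + b * signedArea z q r := by
          simp [signedArea]
          ring
        rw [e, add_div, mul_div_assoc, mul_div_assoc]
        exact add_nonneg (mul_nonneg ha hy₁) (mul_nonneg hb hz₁)
      · have e : signedArea p ((1 - b) • y + b • z) r =
            (1 - b) * signedArea p y r + b * signedArea p z r := by
          simp [signedArea]
          ring
        rw [e, add_div, mul_div_assoc, mul_div_assoc]
        exact add_nonneg (mul_nonneg ha hy₂) (mul_nonneg hb hz₂)
      · have e : signedArea p q ((1 - b) • y + b • z) =
            (1 - b) * signedArea p q y + b * signedArea p q z := by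
          simp [signedArea]
          ring
        rw [e, add_div, mul_div_assoc, mul_div_assoc]
        exact add_nonneg (mul_nonneg ha hy₃) (mul_nonneg hb hz₃)
    have hz : ∀ y z : Plane, signedArea y z z = 0 ∧ signedArea y y z = 0 ∧
        signedArea y z y = 0 := by
      intro y z
      simp only [signedArea]
      refine ⟨?_, ?_, ?_⟩ <;> ring
    refine convexHull_min ?_ hconv hx
    rintro y (rfl | rfl | rfl) <;> simp [hz, div_self hD]
  · rintro ⟨h₁, h₂, h₃⟩
    have hx : x = (signedArea x q r / signedArea p q r) • p +
        (signedArea p x r / signedArea p q r) • q + (signedArea p q x / signedArea p q r) • r := by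
      ext e
      rw [hsum]
      simpa using hb.2 e
    rw [hx]
    have hc := convex_convexHull ℝ ({p, q, r} : Set Plane)
    have hs := subset_convexHull ℝ ({p, q, r} : Set Plane)
    have := hc.sum_mem (t := Finset.univ)
      (w := ![signedArea x q r / signedArea p q r, signedArea p x r / signedArea p q r,
        signedArea p q x / signedArea p q r]) (z := ![p, q, r])
      (by intro i _; fin_cases i <;> simpa)
      (by simp only [Fin.sum_univ_three, Matrix.cons_val]; linarith)
      (by intro i _; fin_cases i <;> exact hs (by simp))
    simpa [Fin.sum_univ_three] using this

theorem mem_triangle_iff {v : Fin 3 → Plane} (hv : signedArea (v 0) (v 1) (v 2) ≠ 0) (x : Plane) :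
    x ∈ triangle v ↔ 0 ≤ 1 - coordS v x - coordT v x ∧ 0 ≤ coordS v x ∧ 0 ≤ coordT v x := by
  have hr : Set.range v = {v 0, v 1, v 2} := by
    ext y
    simp [Fin.exists_fin_succ, eq_comm]
  have h1 : signedArea x (v 1) (v 2) / signedArea (v 0) (v 1) (v 2) =
      1 - coordS v x - coordT v x := by
    unfold coordS coordT
    field_simp
    simp only [signedArea]
    ring
  rw [triangle, hr, mem_convexHull_triple hv, h1, coordS, coordT]

/-! ### The recursion on a face computes the spline -/

/-- The knot multiplicities encoded by `K`. -/
def knotsOf (K : ℕ) (i : Fin 10) : ℕ := if i.val < 6 then digit K i else 0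

/-- Indices below ten as elements of `Fin 10`. -/
def toFinTriple (t : ℕ × ℕ × ℕ) : Fin 10 × Fin 10 × Fin 10 :=
  (Fin.ofNat 10 t.1, Fin.ofNat 10 t.2.1, Fin.ofNat 10 t.2.2)

theorem digit_eq (K i : ℕ) : digit K i = K / 16 ^ i % 16 := by
  unfold digit
  have h1 : ∀ x : ℕ, Nat.land x 15 = x % 16 := fun x => Nat.and_two_pow_sub_one_eq_mod x 4
  have h2 : Nat.shiftRight K (Nat.mul 4 i) = K / 2 ^ (4 * i) := Nat.shiftRight_eq_div_pow K (4 * i)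
  rw [h1, h2, pow_mul]
  norm_num

theorem knotsOf_sub {K i : ℕ} (hi : i < 6) (h : 1 ≤ digit K i) :
    knotsOf (K - 16 ^ i) = knotsOf K - Pi.single (Fin.ofNat 10 i) 1 := by
  rw [digit_eq] at h
  funext j
  simp only [knotsOf, Pi.sub_apply, digit_eq]
  by_cases hj : j.val < 6
  · rw [if_pos hj, if_pos hj]
    by_cases hij : j = Fin.ofNat 10 i
    · subst hij
      have hval : (Fin.ofNat 10 i).val = i := Nat.mod_eq_of_lt (by omega)
      rw [Pi.single_eq_same, hval]
      interval_cases i <;> omega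
    · rw [Pi.single_eq_of_ne hij]
      have hval : j.val ≠ i := by
        rintro rfl
        exact hij (by simp)
      generalize j.val = m at *
      interval_cases i <;> interval_cases m <;> omega
  · rw [if_neg hj, if_neg hj]
    omega

theorem signedArea_vertex (v : Fin 3 → Plane) {i j k : ℕ} (hi : i < 6) (hj : j < 6) (hk : k < 6) :
    signedArea (vertex v (Fin.ofNat 10 i)) (vertex v (Fin.ofNat 10 j))
      (vertex v (Fin.ofNat 10 k)) =
      det3 (knotBary i) (knotBary j) (knotBary k) / 8 * signedArea (v 0) (v 1) (v 2) := by
  rw [signedArea_of_isBary (isBary_vertex v hi) (isBary_vertex v hj) (isBary_vertex v hk)]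
  simp only [det3, dot, cross]
  push_cast
  ring

/-- Only the set `S` of the knots that occur matters for the first noncollinear triple. For each of
the sets of knots among `v₁, …, v₆`, the lexicographically first noncollinear triple is increasing. -/
theorem find_firstTriple_check :
    ∀ S : Fin 6 → Bool,
      ((List.finRange 10 ×ˢ (List.finRange 10 ×ˢ List.finRange 10)).find? fun t =>
        (if h : t.1.val < 6 then S ⟨t.1, h⟩ else false) &&
        ((if h : t.2.1.val < 6 then S ⟨t.2.1, h⟩ else false) &&
        ((if h : t.2.2.val < 6 then S ⟨t.2.2, h⟩ else false) &&
          det3 (knotBary t.1) (knotBary t.2.1) (knotBary t.2.2) != 0))) =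
      (knotTriples.find? fun t =>
        (if h : t.1 < 6 then S ⟨t.1, h⟩ else false) &&
        ((if h : t.2.1 < 6 then S ⟨t.2.1, h⟩ else false) &&
        (if h : t.2.2 < 6 then S ⟨t.2.2, h⟩ else false))).map toFinTriple := by
  decide +kernel

/-- The facts about the increasing noncollinear triples of knots that make the integer divisions in
`leafPoly` and `stepPoly` exact. -/
theorem knotTriples_check :
    ∀ t ∈ knotTriples, (t.1 < 6 ∧ t.2.1 < 6 ∧ t.2.2 < 6) ∧
      (let p := knotBary t.1
       let q := knotBary t.2.1
       let r := knotBary t.2.2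
       let D := det3 p q r
       D ≠ 0 ∧ |D| ∣ 8 ∧ ∀ c ∈ [cross q r, cross r p, cross p q],
        D ∣ 2 * c.1 ∧ D ∣ 2 * c.2.1 ∧ D ∣ 2 * c.2.2) := by
  decide +kernel

theorem firstTriple_knotsOf {v : Fin 3 → Plane} (hv : signedArea (v 0) (v 1) (v 2) ≠ 0) (K : ℕ) :
    firstTriple v (knotsOf K) = (firstCode K).map toFinTriple := by
  have h := find_firstTriple_check fun i => Nat.ble 1 (digit K i)
  have hcode : firstCode K = knotTriples.find? fun t =>
      (if h : t.1 < 6 then Nat.ble 1 (digit K t.1) else false) &&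
      ((if h : t.2.1 < 6 then Nat.ble 1 (digit K t.2.1) else false) &&
      (if h : t.2.2 < 6 then Nat.ble 1 (digit K t.2.2) else false)) := by
    refine List.find?_congr fun t ht => ?_
    obtain ⟨⟨h1, h2, h3⟩, -⟩ := knotTriples_check t ht
    simp [h1, h2, h3]
  rw [hcode, ← h, firstTriple]
  refine List.find?_congr fun t _ => ?_
  rw [Bool.eq_iff_iff]
  have hpos : ∀ i : Fin 10, 0 < knotsOf K i ↔
      (if h : i.val < 6 then Nat.ble 1 (digit K i) else false) = true := by
    intro i
    unfold knotsOf
    by_cases hi : i.val < 6 <;> simp [hi, Nat.pos_iff_ne_zero, Nat.one_le_iff_ne_zero]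
  simp only [Bool.and_eq_true, decide_eq_true_eq, ← hpos, bne_iff_ne]
  have hlt : ∀ i : Fin 10, 0 < knotsOf K i → i.val < 6 := by
    intro i
    unfold knotsOf
    split_ifs with h <;> simp [h]
  refine and_congr_right fun h1 => and_congr_right fun h2 => and_congr_right fun h3 => not_congr ?_
  have := signedArea_vertex v (hlt _ h1) (hlt _ h2) (hlt _ h3)
  simp only [Fin.ofNat_eq_cast, Fin.cast_val_eq_self] at this
  rw [this]
  simp [hv]

theorem firstCode_spec {K i j k : ℕ} (h : firstCode K = some (i, j, k)) :
    (i, j, k) ∈ knotTriples ∧ 1 ≤ digit K i ∧ 1 ≤ digit K j ∧ 1 ≤ digit K k := by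
  refine ⟨List.mem_of_find?_eq_some h, ?_⟩
  have := List.find?_some h
  simpa [Nat.ble_eq] using this

theorem formEval_baryForm {q r : Triple} {D : ℤ} (hD : D ≠ 0)
    (h : D ∣ 2 * (cross q r).1 ∧ D ∣ 2 * (cross q r).2.1 ∧ D ∣ 2 * (cross q r).2.2) (s t : ℝ) :
    formEval (baryForm q r D) s t = 2 * formEval (cross q r) s t / D := by
  have hD' : (D : ℝ) ≠ 0 := by exact_mod_cast hD
  simp only [formEval, baryForm]
  rw [Int.cast_div h.1 hD', Int.cast_div h.2.1 hD', Int.cast_div h.2.2 hD']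
  push_cast
  field_simp

theorem signedArea_right_vertex {v : Fin 3 → Plane} (hv : signedArea (v 0) (v 1) (v 2) ≠ 0)
    (x : Plane) {j k : ℕ} (hj : j < 6) (hk : k < 6) :
    signedArea x (vertex v (Fin.ofNat 10 j)) (vertex v (Fin.ofNat 10 k)) =
      formEval (cross (knotBary j) (knotBary k)) (coordS v x) (coordT v x) / 4 *
        signedArea (v 0) (v 1) (v 2) := by
  rw [signedArea_of_isBary (isBary_coord hv x) (isBary_vertex v hj) (isBary_vertex v hk)]
  simp only [formEval, cross]
  push_cast
  ring

theorem signedArea_rotate (p q r : Plane) : signedArea p q r = signedArea q r p := by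
  simp only [signedArea]
  ring

/-- The points on the segment from `x` to the generic point that are close to `x` lie on the same
sides as `f` of all lines through two of the knots `v₁, …, v₆`. -/
def InFace (v : Fin 3 → Plane) (f : Triple) (x : Plane) : Prop :=
  ∀ᶠ ε in 𝓝[>] (0 : ℝ), ∀ j < 6, ∀ k < 6, j ≠ k →
    0 < (dot f (cross (knotBary j) (knotBary k)) : ℝ) *
      formEval (cross (knotBary j) (knotBary k))
        (coordS v (AffineMap.lineMap x (genericPoint v) ε))
        (coordT v (AffineMap.lineMap x (genericPoint v) ε))

theorem ratio_eq {v : Fin 3 → Plane} (hv : signedArea (v 0) (v 1) (v 2) ≠ 0) (x : Plane)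
    {i j k : ℕ} (hi : i < 6) (hj : j < 6) (hk : k < 6)
    (hD : det3 (knotBary i) (knotBary j) (knotBary k) ≠ 0) {a b : ℕ} (ha : a < 6) (hb : b < 6) :
    signedArea x (vertex v (Fin.ofNat 10 a)) (vertex v (Fin.ofNat 10 b)) /
      signedArea (vertex v (Fin.ofNat 10 i)) (vertex v (Fin.ofNat 10 j))
        (vertex v (Fin.ofNat 10 k)) =
      2 * formEval (cross (knotBary a) (knotBary b)) (coordS v x) (coordT v x) /
        det3 (knotBary i) (knotBary j) (knotBary k) := by
  have hD' : ((det3 (knotBary i) (knotBary j) (knotBary k) : ℤ) : ℝ) ≠ 0 := by exact_mod_cast hD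
  rw [signedArea_right_vertex hv x ha hb, signedArea_vertex v hi hj hk]
  field_simp
  ring

/-- Whether a point of the face of `f` belongs to `[K)`, for three knots `K`, can be tested at `f`. -/
theorem mem_halfOpenHull_iff {v : Fin 3 → Plane} (hv : signedArea (v 0) (v 1) (v 2) ≠ 0)
    {f : Triple} {x : Plane} (hx : InFace v f x) {i j k : ℕ} (hi : i < 6) (hj : j < 6) (hk : k < 6)
    (hD : det3 (knotBary i) (knotBary j) (knotBary k) ≠ 0) :
    x ∈ halfOpenHull v {vertex v (Fin.ofNat 10 i), vertex v (Fin.ofNat 10 j),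
        vertex v (Fin.ofNat 10 k)} ↔
      0 < det3 (knotBary i) (knotBary j) (knotBary k) *
        dot f (cross (knotBary j) (knotBary k)) ∧
      0 < det3 (knotBary i) (knotBary j) (knotBary k) *
        dot f (cross (knotBary k) (knotBary i)) ∧
      0 < det3 (knotBary i) (knotBary j) (knotBary k) *
        dot f (cross (knotBary i) (knotBary j)) := by
  have hij : i ≠ j := by
    rintro rfl
    apply hD
    simp only [det3, dot, cross]
    ring
  have hjk : j ≠ k := by
    rintro rfl
    apply hD
    simp only [det3, dot, cross]
    ring
  have hki : k ≠ i := by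
    rintro rfl
    apply hD
    simp only [det3, dot, cross]
    ring
  have hS : signedArea (vertex v (Fin.ofNat 10 i)) (vertex v (Fin.ofNat 10 j))
      (vertex v (Fin.ofNat 10 k)) ≠ 0 := by
    rw [signedArea_vertex v hi hj hk]
    simp [hv, hD]
  have hD' : ((det3 (knotBary i) (knotBary j) (knotBary k) : ℤ) : ℝ) ≠ 0 := by exact_mod_cast hD
  -- A form with the same sign as at `f` is nonnegative relative to `D` exactly if it is so at `f`.
  have sgn : ∀ {a : ℤ} {b : ℝ}, 0 < (a : ℝ) * b →
      (0 ≤ 2 * b / (det3 (knotBary i) (knotBary j) (knotBary k) : ℤ) ↔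
        0 < det3 (knotBary i) (knotBary j) (knotBary k) * a) := by
    intro a b hab
    rw [← Int.cast_pos (R := ℝ), Int.cast_mul]
    generalize ((det3 (knotBary i) (knotBary j) (knotBary k) : ℤ) : ℝ) = D at *
    rcases lt_or_gt_of_ne hD' with h | h <;>
      rcases (mul_pos_iff.mp hab) with ⟨h1, h2⟩ | ⟨h1, h2⟩
    · exact iff_of_false (not_le.mpr (div_neg_of_pos_of_neg (by linarith) h))
        (not_lt.mpr (mul_nonpos_of_nonpos_of_nonneg h.le h1.le))
    · exact iff_of_true (div_nonneg_of_nonpos (by linarith) h.le) (mul_pos_of_neg_of_neg h h1)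
    · exact iff_of_true (div_nonneg (by linarith) h.le) (mul_pos h h1)
    · exact iff_of_false (not_le.mpr (div_neg_of_neg_of_pos (by linarith) h))
        (not_lt.mpr (mul_nonpos_of_nonneg_of_nonpos h.le h1.le))
  change (∀ᶠ ε in 𝓝[>] (0 : ℝ), AffineMap.lineMap x (genericPoint v) ε ∈ convexHull ℝ _) ↔ _
  refine Iff.trans (Filter.eventually_congr ?_) Filter.eventually_const
  filter_upwards [hx] with ε hε
  rw [mem_convexHull_triple hS,
    signedArea_rotate (vertex v (Fin.ofNat 10 i)) (AffineMap.lineMap x (genericPoint v) ε),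
    ← signedArea_rotate (AffineMap.lineMap x (genericPoint v) ε) (vertex v (Fin.ofNat 10 i)),
    ratio_eq hv _ hi hj hk hD hj hk, ratio_eq hv _ hi hj hk hD hk hi,
    ratio_eq hv _ hi hj hk hD hi hj, sgn (hε j hj k hk hjk), sgn (hε k hk i hi hki),
    sgn (hε i hi j hj hij)]

/-- On the points assigned to a face, the spline equals the polynomial computed for this face. -/
theorem simplexSplineAux_eq {v : Fin 3 → Plane} (hv : signedArea (v 0) (v 1) (v 2) ≠ 0)
    {f : Triple} {x : Plane} (hx : InFace v f x) (d K : ℕ) :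
    simplexSplineAux v d (knotsOf K) x =
      (toPoly (facePoly f d K)).evalEval (coordS v x) (coordT v x) := by
  induction d generalizing K with
  | zero =>
    rw [simplexSplineAux, firstTriple_knotsOf hv, facePoly, leafPoly]
    rcases hK : firstCode K with _ | ⟨i, j, k⟩
    · simp [toPoly]
    · obtain ⟨hmem, -⟩ := firstCode_spec hK
      obtain ⟨⟨hi, hj, hk⟩, hD, hdvd, -⟩ := knotTriples_check _ hmem
      have hD' : ((det3 (knotBary i) (knotBary j) (knotBary k) : ℤ) : ℝ) ≠ 0 := by
        exact_mod_cast hD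
      simp only [Option.map_some, toFinTriple]
      have hiff := mem_halfOpenHull_iff hv hx hi hj hk hD
      by_cases hin : x ∈ halfOpenHull v {vertex v (Fin.ofNat 10 i), vertex v (Fin.ofNat 10 j),
        vertex v (Fin.ofNat 10 k)}
      · rw [Set.indicator_of_mem hin, if_pos (hiff.mp hin)]
        have hA : |signedArea (v 0) (v 1) (v 2)| ≠ 0 := abs_ne_zero.mpr hv
        rw [signedArea_vertex v hi hj hk, abs_mul, abs_div]
        have : ((8 / |det3 (knotBary i) (knotBary j) (knotBary k)| : ℤ) : ℝ) =
            8 / |((det3 (knotBary i) (knotBary j) (knotBary k) : ℤ) : ℝ)| := by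
          rw [Int.cast_div hdvd (by simpa using hD'), Int.cast_abs]
          norm_num
        simp only [toPoly, rowPoly, this, mul_zero, add_zero, evalEval_C, eval_C]
        have h3 := abs_ne_zero.mpr hD'
        rw [abs_of_pos (by norm_num : (0 : ℝ) < 8)]
        field_simp
      · rw [Set.indicator_of_notMem hin, if_neg (mt hiff.mpr hin)]
        simp [toPoly]
  | succ d ih =>
    rw [simplexSplineAux, firstTriple_knotsOf hv, facePoly, stepPoly]
    rcases hK : firstCode K with _ | ⟨i, j, k⟩
    · simp [toPoly]
    · obtain ⟨hmem, h1, h2, h3⟩ := firstCode_spec hK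
      obtain ⟨⟨hi, hj, hk⟩, hD, -, hdvd⟩ := knotTriples_check _ hmem
      simp only [List.mem_cons, List.not_mem_nil, or_false, forall_eq_or_imp, forall_eq] at hdvd
      simp only [Option.map_some, toFinTriple]
      rw [← knotsOf_sub hi h1, ← knotsOf_sub hj h2, ← knotsOf_sub hk h3, ih, ih, ih,
        toPoly_polyAdd, toPoly_polyAdd, evalEval_add, evalEval_add, evalEval_polyMulForm,
        evalEval_polyMulForm, evalEval_polyMulForm, formEval_baryForm hD hdvd.1,
        formEval_baryForm hD hdvd.2.1, formEval_baryForm hD hdvd.2.2, ← add_assoc]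
      rw [ratio_eq hv x hi hj hk hD hj hk, signedArea_rotate (vertex v (Fin.ofNat 10 i)) x,
        ratio_eq hv x hi hj hk hD hk hi, ← signedArea_rotate x, ratio_eq hv x hi hj hk hD hi hj]

/-! ### Every point of the triangle belongs to a face -/

/-- The linear forms vanishing on the lines of the 12-split: the three edges and the six interior
lines. -/
def lineForms : List Triple :=
  [(1, 0, 0), (0, 1, 0), (0, 0, 1), (0, -1, 1), (-1, 0, 1), (-1, 1, 0), (-1, 1, 1), (-1, 1, -1),
    (-1, -1, 1)]

theorem cross_knotBary_check :
    ∀ j < 6, ∀ k < 6, j ≠ k → ∃ l ∈ lineForms, ∃ c ∈ [1, -1, 2, -2, 4, -4],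
      cross (knotBary j) (knotBary k) = (c * l.1, c * l.2.1, c * l.2.2) := by
  decide +kernel

theorem lineForms_generic_check : ∀ l ∈ lineForms, dot (9, 4, 1) l ≠ 0 := by
  decide +kernel

theorem exists_face_of_ne_zero {s t : ℝ} (hr : 0 < 1 - s - t) (hs : 0 < s) (ht : 0 < t)
    (h : ∀ l ∈ lineForms, formEval l s t ≠ 0) :
    ∃ f ∈ faces, ∀ l ∈ lineForms, 0 < (dot f l : ℝ) * formEval l s t := by
  simp only [lineForms, List.mem_cons, List.not_mem_nil, or_false, forall_eq_or_imp, forall_eq,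
    formEval] at h ⊢
  obtain ⟨-, -, -, h1, h2, h3, h4, h5, h6⟩ := h
  have hst := lt_or_gt_of_ne (fun e : s = t => h1 (by push_cast; linarith))
  have hrt := lt_or_gt_of_ne (fun e : 1 - s - t = t => h2 (by push_cast; linarith))
  have hrs := lt_or_gt_of_ne (fun e : 1 - s - t = s => h3 (by push_cast; linarith))
  have hr2 := lt_or_gt_of_ne (fun e : 1 - s - t = 1 / 2 => h4 (by push_cast; linarith))
  have hs2 := lt_or_gt_of_ne (fun e : s = 1 / 2 => h5 (by push_cast; linarith))
  have ht2 := lt_or_gt_of_ne (fun e : t = 1 / 2 => h6 (by push_cast; linarith))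
  -- The order of the coordinates and whether the largest exceeds `1 / 2` determine the face.
  rcases hst with hst | hst <;> rcases hrt with hrt | hrt <;> rcases hrs with hrs | hrs
  · rcases ht2 with h | h
    · exact ⟨(20, 35, 45), by simp [faces], by norm_num [dot]; and_intros <;> linarith⟩
    · exact ⟨(15, 25, 60), by simp [faces], by norm_num [dot]; and_intros <;> linarith⟩
  · rcases ht2 with h | h
    · exact ⟨(35, 20, 45), by simp [faces], by norm_num [dot]; and_intros <;> linarith⟩
    · exact ⟨(25, 15, 60), by simp [faces], by norm_num [dot]; and_intros <;> linarith⟩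
  · linarith
  · rcases hr2 with h | h
    · exact ⟨(45, 20, 35), by simp [faces], by norm_num [dot]; and_intros <;> linarith⟩
    · exact ⟨(60, 15, 25), by simp [faces], by norm_num [dot]; and_intros <;> linarith⟩
  · rcases hs2 with h | h
    · exact ⟨(20, 45, 35), by simp [faces], by norm_num [dot]; and_intros <;> linarith⟩
    · exact ⟨(15, 60, 25), by simp [faces], by norm_num [dot]; and_intros <;> linarith⟩
  · linarith
  · rcases hs2 with h | h
    · exact ⟨(35, 45, 20), by simp [faces], by norm_num [dot]; and_intros <;> linarith⟩
    · exact ⟨(25, 60, 15), by simp [faces], by norm_num [dot]; and_intros <;> linarith⟩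
  · rcases hr2 with h | h
    · exact ⟨(45, 35, 20), by simp [faces], by norm_num [dot]; and_intros <;> linarith⟩
    · exact ⟨(60, 25, 15), by simp [faces], by norm_num [dot]; and_intros <;> linarith⟩

theorem coord_lineMap {v : Fin 3 → Plane} (hv : signedArea (v 0) (v 1) (v 2) ≠ 0) (x : Plane)
    (ε : ℝ) :
    coordS v (AffineMap.lineMap x (genericPoint v) ε) = (1 - ε) * coordS v x + ε * (4 / 14) ∧
    coordT v (AffineMap.lineMap x (genericPoint v) ε) = (1 - ε) * coordT v x + ε * (1 / 14) := by
  have hb : IsBary v (AffineMap.lineMap x (genericPoint v) ε)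
      ((1 - ε) * (1 - coordS v x - coordT v x) + ε * (9 / 14))
      ((1 - ε) * coordS v x + ε * (4 / 14)) ((1 - ε) * coordT v x + ε * (1 / 14)) := by
    refine ⟨by ring, fun e => ?_⟩
    have hx := (isBary_coord hv x).2 e
    simp only [AffineMap.lineMap_apply_module, genericPoint, PiLp.add_apply, PiLp.smul_apply,
      smul_eq_mul]
    rw [hx]
    ring
  exact ⟨hb.coordS_eq hv, hb.coordT_eq hv⟩

/-- Each point of the triangle, boundary included, is assigned to one of the twelve faces. -/
theorem exists_inFace {v : Fin 3 → Plane} (hv : signedArea (v 0) (v 1) (v 2) ≠ 0) {x : Plane}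
    (hx : x ∈ triangle v) : ∃ f ∈ faces, InFace v f x := by
  rw [mem_triangle_iff hv] at hx
  obtain ⟨hr, hs, ht⟩ := hx
  set s := coordS v x
  set t := coordT v x
  have hform : ∀ (l : Triple) (ε : ℝ),
      formEval l (coordS v (AffineMap.lineMap x (genericPoint v) ε))
        (coordT v (AffineMap.lineMap x (genericPoint v) ε)) =
      (1 - ε) * formEval l s t + ε * ((dot (9, 4, 1) l : ℝ) / 14) := by
    intro l ε
    rw [(coord_lineMap hv x ε).1, (coord_lineMap hv x ε).2]
    simp only [formEval, dot]
    push_cast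
    ring
  -- Along the segment towards the generic point each form has eventually a constant sign: its sign
  -- at `x`, or at the generic point if it vanishes at `x`.
  have hsign : ∀ l : Triple, ∃ S : ℝ, l ∈ lineForms → ∀ᶠ ε in 𝓝[>] (0 : ℝ),
      0 < formEval l (coordS v (AffineMap.lineMap x (genericPoint v) ε))
        (coordT v (AffineMap.lineMap x (genericPoint v) ε)) * S := by
    intro l
    by_cases h0 : formEval l s t = 0
    · refine ⟨(dot (9, 4, 1) l : ℝ) / 14, fun hl => ?_⟩
      have hne : ((dot (9, 4, 1) l : ℤ) : ℝ) / 14 ≠ 0 :=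
        div_ne_zero (by exact_mod_cast lineForms_generic_check l hl) (by norm_num)
      filter_upwards [self_mem_nhdsWithin] with ε hε
      rw [hform, h0, mul_zero, zero_add, mul_assoc]
      exact mul_pos hε (mul_self_pos.mpr hne)
    · refine ⟨formEval l s t, fun _ => ?_⟩
      have hc : ContinuousAt (fun ε : ℝ => ((1 - ε) * formEval l s t +
          ε * ((dot (9, 4, 1) l : ℝ) / 14)) * formEval l s t) 0 := by fun_prop
      have hpos : (0 : ℝ) < ((1 - 0) * formEval l s t +
          0 * ((dot (9, 4, 1) l : ℝ) / 14)) * formEval l s t := by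
        have := mul_self_pos.mpr h0
        linarith
      filter_upwards [nhdsWithin_le_nhds (hc.eventually (lt_mem_nhds hpos))] with ε hε
      rw [hform]
      exact hε
  choose S hS using hsign
  have hall : ∀ᶠ ε in 𝓝[>] (0 : ℝ), ∀ l ∈ lineForms,
      0 < formEval l (coordS v (AffineMap.lineMap x (genericPoint v) ε))
        (coordT v (AffineMap.lineMap x (genericPoint v) ε)) * S l :=
    (Filter.eventually_all_finite (List.finite_toSet lineForms)).mpr hS
  have hlt : ∀ᶠ ε in 𝓝[>] (0 : ℝ), ε < 1 := nhdsWithin_le_nhds (gt_mem_nhds one_pos)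
  obtain ⟨ε, ⟨hε, hε1⟩, hε0⟩ := ((hall.and hlt).and self_mem_nhdsWithin).exists
  have hε0 : 0 < ε := hε0
  obtain ⟨f, hf, hfl⟩ := exists_face_of_ne_zero
    (s := coordS v (AffineMap.lineMap x (genericPoint v) ε))
    (t := coordT v (AffineMap.lineMap x (genericPoint v) ε))
    (by
      rw [(coord_lineMap hv x ε).1, (coord_lineMap hv x ε).2]
      nlinarith [mul_nonneg (sub_nonneg.mpr hε1.le) hr])
    (by
      rw [(coord_lineMap hv x ε).1]
      nlinarith [mul_nonneg (sub_nonneg.mpr hε1.le) hs])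
    (by
      rw [(coord_lineMap hv x ε).2]
      nlinarith [mul_nonneg (sub_nonneg.mpr hε1.le) ht])
    (fun l hl h0 => by
      have := hε l hl
      rw [h0, zero_mul] at this
      exact this.false)
  refine ⟨f, hf, ?_⟩
  filter_upwards [hall] with ε' hε' j hj k hk hjk
  obtain ⟨l, hl, c, hc, hcross⟩ := cross_knotBary_check j hj k hk hjk
  have hc0 : (c : ℝ) ≠ 0 := by
    simp only [List.mem_cons, List.not_mem_nil, or_false] at hc
    rcases hc with rfl | rfl | rfl | rfl | rfl | rfl <;> norm_num
  have hy := hε l hl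
  have h1 := mul_pos (mul_pos (hε' l hl) hy) (hfl l hl)
  rw [hcross]
  generalize coordS v (AffineMap.lineMap x (genericPoint v) ε') = s' at *
  generalize coordT v (AffineMap.lineMap x (genericPoint v) ε') = t' at *
  generalize formEval l (coordS v (AffineMap.lineMap x (genericPoint v) ε))
        (coordT v (AffineMap.lineMap x (genericPoint v) ε)) = y at *
  have h2 : (dot f (c * l.1, c * l.2.1, c * l.2.2) : ℝ) *
      formEval (c * l.1, c * l.2.1, c * l.2.2) s' t' =
      (c : ℝ) ^ 2 * ((dot f l : ℝ) * formEval l s' t') := by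
    simp only [dot, formEval]
    push_cast
    ring
  rw [h2]
  refine mul_pos (by positivity) ?_
  have h3 : (0 : ℝ) < (y * S l) ^ 2 := pow_pos hy 2
  have h4 : formEval l s' t' * S l * (y * S l) * ((dot f l : ℝ) * y) =
      (dot f l : ℝ) * formEval l s' t' * (y * S l) ^ 2 := by ring
  rw [h4] at h1
  exact (mul_pos_iff_of_pos_right h3).mp h1

/-! ### One-sided contact of polynomials -/

theorem contDiff_eval (p : ℝ[X]) {n : WithTop ℕ∞} : ContDiff ℝ n fun x => p.eval x := by
  simpa using p.contDiff_aeval (𝕜 := ℝ) n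

theorem iteratedDeriv_eval_zero (p : ℝ[X]) (k : ℕ) :
    iteratedDeriv k (fun x => p.eval x) 0 = k.factorial * p.coeff k := by
  have h : ∀ k, iteratedDeriv k (fun x => p.eval x) = fun x => (derivative^[k] p).eval x := by
    intro k
    induction k with
    | zero => simp
    | succ k ih =>
      rw [iteratedDeriv_succ, ih]
      funext x
      rw [Polynomial.deriv, Function.iterate_succ_apply']
  rw [h]
  simp only
  rw [← coeff_zero_eq_eval_zero, coeff_iterate_derivative, zero_add, Nat.descFactorial_self,
    nsmul_eq_mul]

/-- Two polynomials that continue each other to a function of class `C^r` at `0` have the same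
coefficients up to order `r`. -/
theorem coeff_eq_of_contDiffAt {h : ℝ → ℝ} {p q : ℝ[X]} {r : ℕ} (hh : ContDiffAt ℝ r h 0)
    (hp : ∀ᶠ x in 𝓝[≥] (0 : ℝ), h x = p.eval x) (hq : ∀ᶠ x in 𝓝[≤] (0 : ℝ), h x = q.eval x)
    {k : ℕ} (hk : k ≤ r) : p.coeff k = q.coeff k := by
  have main : ∀ (s : Set ℝ) (u : ℝ[X]), UniqueDiffOn ℝ s → (0 : ℝ) ∈ s →
      (∀ᶠ x in 𝓝[s] (0 : ℝ), h x = u.eval x) → iteratedDeriv k h 0 = k.factorial * u.coeff k := by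
    intro s u hs h0 hu
    rw [← iteratedDeriv_eval_zero,
      ← iteratedDerivWithin_eq_iteratedDeriv hs (hh.of_le (by exact_mod_cast hk)) h0,
      ← iteratedDerivWithin_eq_iteratedDeriv hs (contDiff_eval u).contDiffAt h0]
    exact Filter.EventuallyEq.iteratedDerivWithin_eq hu (hu.self_of_nhdsWithin h0)
  have h1 := main (Set.Ici 0) p (uniqueDiffOn_Ici 0) Set.self_mem_Ici hp
  have h2 := main (Set.Iic 0) q (uniqueDiffOn_Iic 0) Set.self_mem_Iic hq
  exact mul_left_cancel₀ (by positivity) (h1.symm.trans h2)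

/-! ### Smooth functions that meet along the intersection of two closed sets -/

theorem iteratedFDeriv_pow_mul_eq_zero {E : Type*} [NormedAddCommGroup E] [NormedSpace ℝ E]
    {l g : E → ℝ} (hl : ContDiff ℝ ⊤ l) (hg : ContDiff ℝ ⊤ g) {x : E} (hx : l x = 0) {n k : ℕ}
    (hk : k < n) : iteratedFDeriv ℝ k (fun y => l y ^ n * g y) x = 0 := by
  induction n generalizing k with
  | zero => omega
  | succ n ih =>
    have e : (fun y => l y ^ (n + 1) * g y) = fun y => l y * (l y ^ n * g y) := by
      funext y
      ring
    rw [e, ← norm_le_zero_iff]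
    refine (norm_iteratedFDeriv_mul_le hl ((hl.pow n).mul hg) x (n := k)
      (by exact_mod_cast le_top)).trans (Finset.sum_nonpos fun i hi => ?_)
    rcases Nat.eq_zero_or_pos i with rfl | hi0
    · simp [hx]
    · rw [ih (k := k - i) (by rw [Finset.mem_range] at hi; omega)]
      simp

/-- Two smooth functions whose derivatives agree on the intersection of two closed sets make up a
smooth function on the union. -/
theorem contDiffOn_piecewise {E : Type*} [NormedAddCommGroup E] [NormedSpace ℝ E]
    {S T : Set E} [∀ x, Decidable (x ∈ S)] (hS : IsClosed S) (hT : IsClosed T) {f g : E → ℝ} {r : ℕ}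
    (hf : ContDiff ℝ r f) (hg : ContDiff ℝ r g)
    (h : ∀ x ∈ S ∩ T, ∀ k ≤ r, iteratedFDeriv ℝ k f x = iteratedFDeriv ℝ k g x) :
    ContDiffOn ℝ r (S.piecewise f g) (S ∪ T) := by
  have hf' := (contDiff_iff_ftaylorSeries (n := (r : ℕ∞))).mp hf
  have hg' := (contDiff_iff_ftaylorSeries (n := (r : ℕ∞))).mp hg
  let P : E → FormalMultilinearSeries ℝ E ℝ := S.piecewise (ftaylorSeries ℝ f) (ftaylorSeries ℝ g)
  have hPS : ∀ x ∈ S, P x = ftaylorSeries ℝ f x := fun x hx => Set.piecewise_eq_of_mem _ _ _ hx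
  have hPT : ∀ x ∈ T, ∀ m ≤ r, P x m = ftaylorSeries ℝ g x m := by
    intro x hx m hm
    by_cases hxS : x ∈ S
    · rw [hPS x hxS]
      exact h x ⟨hxS, hx⟩ m hm
    · rw [show P x = ftaylorSeries ℝ g x from Set.piecewise_eq_of_notMem _ _ _ hxS]
  refine HasFTaylorSeriesUpToOn.contDiffOn (n := (r : ℕ∞)) (f' := P) ⟨?_, ?_, ?_⟩
  · intro x hx
    by_cases hxS : x ∈ S
    · rw [hPS x hxS, Set.piecewise_eq_of_mem _ _ _ hxS]
      exact hf'.zero_eq x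
    · rw [show P x = ftaylorSeries ℝ g x from Set.piecewise_eq_of_notMem _ _ _ hxS,
        Set.piecewise_eq_of_notMem _ _ _ hxS]
      exact hg'.zero_eq x
  · intro m hm x _
    have hm' : m < r := by exact_mod_cast hm
    refine HasFDerivWithinAt.union ?_ ?_
    · by_cases hxS : x ∈ S
      · rw [hPS x hxS]
        exact ((hf'.fderiv m hm x).hasFDerivWithinAt).congr (fun y hy => by rw [hPS y hy])
          (by rw [hPS x hxS])
      · exact .of_notMem_closure (by rwa [hS.closure_eq])
    · by_cases hxT : x ∈ T
      · rw [hPT x hxT m.succ hm']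
        exact ((hg'.fderiv m hm x).hasFDerivWithinAt).congr (fun y hy => hPT y hy m hm'.le)
          (hPT x hxT m hm'.le)
      · exact .of_notMem_closure (by rwa [hT.closure_eq])
  · intro m hm
    have hm' : m ≤ r := by exact_mod_cast hm
    refine ContinuousOn.union_of_isClosed ?_ ?_ hS hT
    · exact ((hf'.cont m hm).continuousOn).congr fun y hy => by rw [hPS y hy]
    · exact ((hg'.cont m hm).continuousOn).congr fun y hy => hPT y hy m hm'

/-! ### Smooth building blocks -/

theorem contDiff_max_zero_pow (n : ℕ) : ContDiff ℝ n fun x : ℝ => max x 0 ^ (n + 1) := by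
  have hderiv : ∀ (n : ℕ) (x : ℝ), HasDerivAt (fun x : ℝ => max x 0 ^ (n + 2))
      ((n + 2) * max x 0 ^ (n + 1)) x := by
    intro n x
    rcases lt_trichotomy x 0 with hx | rfl | hx
    · rw [max_eq_right hx.le]
      refine ((hasDerivAt_const x (0 : ℝ)).congr_of_eventuallyEq ?_).congr_deriv (by simp)
      filter_upwards [gt_mem_nhds hx] with y hy
      simp [max_eq_right (le_of_lt hy)]
    · rw [max_self, zero_pow (by omega), mul_zero, hasDerivAt_iff_isLittleO_nhds_zero]
      simp only [zero_add, max_self, ne_eq, Nat.add_eq_zero_iff, OfNat.ofNat_ne_zero, and_false,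
        not_false_eq_true, zero_pow, sub_zero, smul_zero]
      refine Asymptotics.IsBigO.trans_isLittleO (g := fun h : ℝ => h ^ (n + 2)) ?_
        (by simpa using Asymptotics.isLittleO_pow_pow (𝕜 := ℝ) (show 1 < n + 2 by omega))
      refine Asymptotics.IsBigO.of_bound 1 (Filter.Eventually.of_forall fun h => ?_)
      rw [one_mul, norm_pow, norm_pow]
      refine pow_le_pow_left₀ (norm_nonneg _) ?_ _
      rw [Real.norm_eq_abs, Real.norm_eq_abs, abs_of_nonneg (le_max_right _ _)]
      exact max_le (le_abs_self h) (abs_nonneg h)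
    · rw [max_eq_left hx.le]
      refine ((hasDerivAt_pow (n + 2) x).congr_of_eventuallyEq ?_).congr_deriv (by push_cast; rfl)
      filter_upwards [lt_mem_nhds hx] with y hy
      simp [max_eq_left (le_of_lt hy)]
  induction n with
  | zero =>
    simp only [zero_add, pow_one]
    exact contDiff_zero.mpr (by fun_prop)
  | succ n ih =>
    have : ((n + 1 : ℕ) : WithTop ℕ∞) = (n : WithTop ℕ∞) + 1 := by push_cast; rfl
    rw [this, contDiff_succ_iff_deriv]
    refine ⟨fun x => (hderiv n x).differentiableAt, by simp, ?_⟩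
    rw [show deriv (fun x : ℝ => max x 0 ^ (n + 1 + 1)) =
      fun x : ℝ => ((n : ℝ) + 2) * max x 0 ^ (n + 1) from funext fun x => (hderiv n x).deriv]
    exact contDiff_const.mul ih

theorem contDiff_evalEval {E : Type*} [NormedAddCommGroup E] [NormedSpace ℝ E] {a b : E → ℝ}
    {n : WithTop ℕ∞} (ha : ContDiff ℝ n a) (hb : ContDiff ℝ n b) (p : ℝ[X][X]) :
    ContDiff ℝ n fun x => p.evalEval (a x) (b x) := by
  induction p using Polynomial.induction_on with
  | C q =>
    simp only [evalEval_C]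
    exact (contDiff_eval q).comp ha
  | add p q hp hq =>
    simp only [evalEval_add]
    exact hp.add hq
  | monomial m q _ =>
    simp only [evalEval_mul, evalEval_C, evalEval_pow, evalEval_X]
    exact ((contDiff_eval q).comp ha).mul (hb.pow _)

/-! ### Linear change of variables in bivariate polynomials -/

/-- The polynomial `p(s + b t, c t)`. -/
def shear (b c : ℝ) (p : ℝ[X][X]) : ℝ[X][X] :=
  p.eval₂ ((compRingHom (C (C b) * X + C X)).comp (mapRingHom C)) (C (C c) * X)

theorem evalEval_shear (b c : ℝ) (p : ℝ[X][X]) (s t : ℝ) :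
    (shear b c p).evalEval s t = p.evalEval (s + b * t) (c * t) := by
  unfold shear
  induction p using Polynomial.induction_on with
  | C q =>
    rw [eval₂_C, evalEval_C]
    induction q using Polynomial.induction_on with
    | C a => simp
    | add q q' hq hq' => rw [map_add, evalEval_add, hq, hq', eval_add]
    | monomial n a h =>
      simp [evalEval_mul, evalEval_pow, evalEval_add, evalEval_C]
      ring_nf
      simp
  | add p q hp hq => rw [eval₂_add, evalEval_add, hp, hq, evalEval_add]
  | monomial n q h =>
    rw [pow_succ, ← mul_assoc, eval₂_mul, evalEval_mul, h, eval₂_X, evalEval_mul]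
    simp [evalEval_mul, evalEval_C]

theorem coeff_shear (b c : ℝ) (p : ℝ[X][X]) (k : ℕ) :
    (shear b c p).coeff k =
      ∑ i ∈ Finset.range (k + 1), C (c ^ i * b ^ (k - i)) * hasseDeriv (k - i) (p.coeff i) := by
  have hφ : ∀ (q : ℝ[X]) (m : ℕ),
      (((q.map C).comp (C (C b) * X + C X) : ℝ[X][X])).coeff m = C (b ^ m) * hasseDeriv m q := by
    intro q m
    have h1 : ((q.map C).comp (C (C b) * X + C X) : ℝ[X][X]) =
        (taylor (X : ℝ[X]) (q.map C)).comp (C (C b) * X) := by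
      rw [taylor_apply, comp_assoc]
      simp
    rw [h1, comp_C_mul_X_coeff, taylor_coeff]
    have h2 : hasseDeriv m (q.map (C : ℝ →+* ℝ[X])) = (hasseDeriv m q).map C := by
      ext i : 1
      simp [hasseDeriv_coeff]
    rw [h2, eval_map, ← comp, comp_X, C_pow, mul_comm]
  induction p using Polynomial.induction_on' with
  | add p q hp hq =>
    have : shear b c (p + q) = shear b c p + shear b c q := by simp [shear, eval₂_add]
    rw [this, coeff_add, hp, hq, ← Finset.sum_add_distrib]
    refine Finset.sum_congr rfl fun i _ => ?_
    rw [coeff_add, map_add, mul_add]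
  | monomial n q =>
    have h1 : shear b c (monomial n q) =
        C (C (c ^ n)) * ((q.map C).comp (C (C b) * X + C X)) * X ^ n := by
      simp only [shear, eval₂_monomial, RingHom.comp_apply, coe_mapRingHom, coe_compRingHom_apply,
        mul_pow, C_pow]
      ring
    rw [h1, coeff_mul_X_pow']
    split_ifs with hn
    · rw [Finset.sum_eq_single n, coeff_monomial_same, coeff_C_mul, hφ, C_mul, mul_assoc]
      · intro i _ hi
        rw [coeff_monomial_of_ne _ hi, map_zero, mul_zero]
      · intro h
        exact absurd (Finset.mem_range.mpr (by omega)) h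
    · refine (Finset.sum_eq_zero fun i hi => ?_).symm
      rw [Finset.mem_range] at hi
      rw [coeff_monomial_of_ne _ (by omega), map_zero, mul_zero]

/-! ### Extension of the splines to the plane -/

/-- The polynomial that the spline with coefficients `c` equals on the face containing `f`. -/
def faceSum (f : Triple) (c : ℕ → ℝ) : ℝ[X][X] :=
  ∑ i ∈ Finset.Icc 1 39, C (C (c i * bcWeight i)) * toPoly (facePoly f 5 (bcCode i))

/-- The linear factor of the jump of the spline with coefficients `c` across the interior
line `k`. -/
def cutSum (k : ℕ) (c : ℕ → ℝ) : ℝ[X][X] :=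
  ∑ i ∈ Finset.Icc 1 39, C (C (c i * bcWeight i)) * toPoly (cutQuotient k (bcCode i))

/-- The `C^3` function on the plane, in the coordinates `s = λ₂`, `t = λ₃`, that extends the spline
with coefficients `c`. -/
def splineExt (c : ℕ → ℝ) (s t : ℝ) : ℝ :=
  (faceSum faceA c).evalEval s t +
    ∑ k ∈ Finset.range 6, (cutSum k c).evalEval s t * max (formEval (cutForm k) s t) 0 ^ 4

/-- The point with coordinates `s`, `t` is not separated from `f` by an interior line of the
12-split. -/
def SameSide (f : Triple) (s t : ℝ) : Prop :=
  ∀ k < 6, 0 ≤ (dot f (cutForm k) : ℝ) * formEval (cutForm k) s t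

theorem evalEval_crossCutPoly (f : Triple) (K : ℕ) (s t : ℝ) :
    (toPoly (crossCutPoly f K)).evalEval s t = (toPoly (facePoly faceA 5 K)).evalEval s t +
      ∑ k ∈ Finset.range 6, if 0 < dot f (cutForm k) then
        (toPoly (cutQuotient k K)).evalEval s t * formEval (cutForm k) s t ^ 4 else 0 := by
  have hstep : ∀ (k : ℕ) (p : IntPoly),
      (toPoly (bif decide (0 < dot f (cutForm k)) then
        polyAdd (cutTerm k K) p else p)).evalEval s t =
      (if 0 < dot f (cutForm k) then
        (toPoly (cutQuotient k K)).evalEval s t * formEval (cutForm k) s t ^ 4 else 0) +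
      (toPoly p).evalEval s t := by
    intro k p
    by_cases h : 0 < dot f (cutForm k)
    · simp only [h, decide_true, cond_true, if_true, toPoly_polyAdd, evalEval_add, cutTerm,
        evalEval_polyMulForm]
      ring
    · simp [h]
  have hl : List.range 6 = [0, 1, 2, 3, 4, 5] := rfl
  rw [crossCutPoly, hl, memoPoly_eq]
  simp only [List.foldr_cons, List.foldr_nil, hstep, Finset.sum_range_succ, Finset.range_zero,
    Finset.sum_empty]
  ring

theorem toPoly_facePoly_eq {f : Triple} (hf : f ∈ faces) {i : ℕ} (hi : i ∈ Finset.Icc 1 39) :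
    toPoly (facePoly f 5 (bcCode i)) = toPoly (crossCutPoly f (bcCode i)) := by
  have hi' : i ∈ List.range' 1 39 := by
    rw [Finset.mem_Icc] at hi
    rw [List.mem_range'_1]
    omega
  rw [← memoPoly_eq]
  exact toPoly_eq_of_polyIsZero (crossCutPoly_check f hf i hi')

theorem dot_cutForm_check : ∀ f ∈ faces, ∀ k < 6, dot f (cutForm k) ≠ 0 := by
  decide +kernel

/-- On the side of the interior lines where a face lies, the extension is the polynomial of this
face. -/
theorem splineExt_eq {f : Triple} (hf : f ∈ faces) (c : ℕ → ℝ) {s t : ℝ} (h : SameSide f s t) :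
    splineExt c s t = (faceSum f c).evalEval s t := by
  have hmax : ∀ k < 6, max (formEval (cutForm k) s t) 0 ^ 4 =
      if 0 < dot f (cutForm k) then formEval (cutForm k) s t ^ 4 else 0 := by
    intro k hk
    have hk' := h k hk
    split_ifs with hpos
    · have : (0 : ℝ) < (dot f (cutForm k) : ℤ) := by exact_mod_cast hpos
      rw [max_eq_left (nonneg_of_mul_nonneg_right hk' this)]
    · have hneg : dot f (cutForm k) < 0 :=
        lt_of_le_of_ne (not_lt.mp hpos) (dot_cutForm_check f hf k hk)
      have : ((dot f (cutForm k) : ℤ) : ℝ) < 0 := by exact_mod_cast hneg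
      rw [max_eq_right (nonpos_of_mul_nonneg_right hk' this)]
      norm_num
  have hcut : ∀ k ∈ Finset.range 6,
      (cutSum k c).evalEval s t * max (formEval (cutForm k) s t) 0 ^ 4 =
      ∑ i ∈ Finset.Icc 1 39, c i * bcWeight i * (if 0 < dot f (cutForm k) then
        (toPoly (cutQuotient k (bcCode i))).evalEval s t * formEval (cutForm k) s t ^ 4
          else 0) := by
    intro k hk
    rw [hmax k (Finset.mem_range.mp hk), cutSum, evalEval_finsetSum, Finset.sum_mul]
    refine Finset.sum_congr rfl fun i _ => ?_
    rw [evalEval_mul, evalEval_C, eval_C]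
    split_ifs <;> ring
  rw [splineExt, Finset.sum_congr rfl hcut, Finset.sum_comm, faceSum, faceSum, evalEval_finsetSum,
    evalEval_finsetSum, ← Finset.sum_add_distrib]
  refine Finset.sum_congr rfl fun i hi => ?_
  rw [toPoly_facePoly_eq hf hi, evalEval_mul, evalEval_mul, evalEval_C, eval_C,
    evalEval_crossCutPoly, mul_add, ← Finset.mul_sum]

theorem bcKnots_check :
    ∀ i ∈ Finset.Icc 1 39, (∀ j, bcKnots i j = knotsOf (bcCode i) j) ∧ ∑ j, bcKnots i j = 8 := by
  decide +kernel

theorem cutForm_check :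
    ∀ k < 6, ∃ a < 6, ∃ b < 6, a ≠ b ∧ ∃ m ∈ [1, -1, 2, -2, 4, -4],
      cross (knotBary a) (knotBary b) =
        (m * (cutForm k).1, m * (cutForm k).2.1, m * (cutForm k).2.2) := by
  decide +kernel

theorem InFace.sameSide {v : Fin 3 → Plane} (hv : signedArea (v 0) (v 1) (v 2) ≠ 0) {f : Triple}
    {x : Plane} (h : InFace v f x) : SameSide f (coordS v x) (coordT v x) := by
  intro k hk
  obtain ⟨a, ha, b, hb, hab, m, hm, hcross⟩ := cutForm_check k hk
  have hm0 : (m : ℝ) ≠ 0 := by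
    simp only [List.mem_cons, List.not_mem_nil, or_false] at hm
    rcases hm with rfl | rfl | rfl | rfl | rfl | rfl <;> norm_num
  have hlim : Filter.Tendsto (fun ε : ℝ => (dot f (cutForm k) : ℝ) *
      formEval (cutForm k) ((1 - ε) * coordS v x + ε * (4 / 14))
        ((1 - ε) * coordT v x + ε * (1 / 14))) (𝓝[>] 0)
      (𝓝 ((dot f (cutForm k) : ℝ) * formEval (cutForm k) (coordS v x) (coordT v x))) := by
    have hc : Continuous (fun ε : ℝ => (dot f (cutForm k) : ℝ) *
      formEval (cutForm k) ((1 - ε) * coordS v x + ε * (4 / 14))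
        ((1 - ε) * coordT v x + ε * (1 / 14))) := by
      unfold formEval
      fun_prop
    have := (hc.tendsto 0).mono_left (nhdsWithin_le_nhds (s := Set.Ioi 0))
    simpa using this
  refine ge_of_tendsto hlim ?_
  filter_upwards [h] with ε hε
  have h1 := hε a ha b hb hab
  rw [(coord_lineMap hv x ε).1, (coord_lineMap hv x ε).2, hcross] at h1
  have h2 : (dot f (m * (cutForm k).1, m * (cutForm k).2.1, m * (cutForm k).2.2) : ℝ) *
      formEval (m * (cutForm k).1, m * (cutForm k).2.1, m * (cutForm k).2.2)
        ((1 - ε) * coordS v x + ε * (4 / 14)) ((1 - ε) * coordT v x + ε * (1 / 14)) =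
      ((dot f (cutForm k) : ℝ) * formEval (cutForm k)
        ((1 - ε) * coordS v x + ε * (4 / 14)) ((1 - ε) * coordT v x + ε * (1 / 14))) *
        (m : ℝ) ^ 2 := by
    simp only [dot, formEval]
    push_cast
    ring
  rw [h2] at h1
  exact ((mul_pos_iff_of_pos_right (by positivity)).mp h1).le

theorem bcSpline_eq {v : Fin 3 → Plane} (hv : signedArea (v 0) (v 1) (v 2) ≠ 0) (c : ℕ → ℝ)
    {x : Plane} (hx : x ∈ triangle v) :
    bcSpline v c x = splineExt c (coordS v x) (coordT v x) := by
  obtain ⟨f, hf, hfx⟩ := exists_inFace hv hx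
  rw [splineExt_eq hf c (hfx.sameSide hv), bcSpline, faceSum, evalEval_finsetSum]
  refine Finset.sum_congr rfl fun i hi => ?_
  obtain ⟨hK, hsum⟩ := bcKnots_check i hi
  rw [evalEval_mul, evalEval_C, eval_C, simplexSpline, hsum, funext hK,
    simplexSplineAux_eq hv hfx]

theorem contDiff_coord (v : Fin 3 → Plane) {n : WithTop ℕ∞} :
    ContDiff ℝ n (coordS v) ∧ ContDiff ℝ n (coordT v) := by
  unfold coordS coordT signedArea
  constructor <;> fun_prop

theorem contDiff_splineExt (v : Fin 3 → Plane) (c : ℕ → ℝ) :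
    ContDiff ℝ 3 fun x => splineExt c (coordS v x) (coordT v x) := by
  obtain ⟨hs, ht⟩ := contDiff_coord v (n := 3)
  refine (contDiff_evalEval hs ht _).add (ContDiff.sum fun k _ =>
    (contDiff_evalEval hs ht _).mul ((contDiff_max_zero_pow 3).comp ?_))
  unfold formEval
  fun_prop

/-! ### Coefficient criterion for smoothness across the edge -/

/-- The part of the edge `t = 0` along which the face of `f` is one of the two faces next to
the edge. -/
def OnEdgeOf (f : Triple) (σ : ℝ) : Prop :=
  f = faceA ∧ σ ∈ Set.Ioo 0 (1 / 2) ∨ f = faceB ∧ σ ∈ Set.Ioo (1 / 2) 1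

theorem OnEdgeOf.mem_faces {f : Triple} {σ : ℝ} (h : OnEdgeOf f σ) : f ∈ faces := by
  rcases h with ⟨rfl, -⟩ | ⟨rfl, -⟩ <;> simp [faces, faceA, faceB]

theorem OnEdgeOf.pos {f : Triple} {σ : ℝ} (h : OnEdgeOf f σ) : 0 < σ ∧ σ < 1 := by
  rcases h with ⟨-, h1, h2⟩ | ⟨-, h1, h2⟩ <;> constructor <;> linarith

theorem OnEdgeOf.eventually_sameSide {f : Triple} {σ : ℝ} (h : OnEdgeOf f σ) :
    ∀ᶠ p : ℝ × ℝ in 𝓝 (σ, 0), SameSide f p.1 p.2 := by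
  have key : ∀ k ∈ Set.Iio 6, ∀ᶠ p : ℝ × ℝ in 𝓝 (σ, 0),
      0 ≤ (dot f (cutForm k) : ℝ) * formEval (cutForm k) p.1 p.2 := by
    intro k hk
    have hc : Continuous fun p : ℝ × ℝ =>
        (dot f (cutForm k) : ℝ) * formEval (cutForm k) p.1 p.2 := by
      unfold formEval
      fun_prop
    have hpos : 0 < (dot f (cutForm k) : ℝ) * formEval (cutForm k) σ 0 := by
      rw [Set.mem_Iio] at hk
      rcases h with ⟨rfl, h1, h2⟩ | ⟨rfl, h1, h2⟩ <;> interval_cases k <;>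
        norm_num [dot, cutForm, faceA, faceB, formEval] <;> linarith
    exact (hc.continuousAt.eventually (lt_mem_nhds hpos)).mono fun p hp => hp.le
  exact (Filter.eventually_all_finite (Set.finite_Iio 6)).mpr key

/-- Two triangles on opposite sides of their common edge: `v'` shares the first two vertices with
`v`, and its third vertex has barycentric coordinates `1 - b - d`, `b`, `d` with `d < 0`. -/
structure AdjacentTriangles (v v' : Fin 3 → Plane) (b d : ℝ) : Prop where
  area_ne : signedArea (v 0) (v 1) (v 2) ≠ 0
  area_ne' : signedArea (v' 0) (v' 1) (v' 2) ≠ 0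
  fst_eq : v' 0 = v 0
  snd_eq : v' 1 = v 1
  third_eq : v' 2 = (1 - b - d) • v 0 + b • v 1 + d • v 2
  neg : d < 0

namespace AdjacentTriangles

variable {v v' : Fin 3 → Plane} {b d : ℝ}

theorem coord_eq (h : AdjacentTriangles v v' b d) (x : Plane) :
    coordS v x = coordS v' x + b * coordT v' x ∧ coordT v x = d * coordT v' x := by
  have hx := (isBary_coord h.area_ne' x).2
  have hb : IsBary v x (1 - (coordS v' x + b * coordT v' x) - d * coordT v' x)
      (coordS v' x + b * coordT v' x) (d * coordT v' x) := by
    refine ⟨by ring, fun e => ?_⟩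
    rw [hx e, h.fst_eq, h.snd_eq, h.third_eq]
    simp only [PiLp.add_apply, PiLp.smul_apply, smul_eq_mul]
    ring
  exact ⟨hb.coordS_eq h.area_ne, hb.coordT_eq h.area_ne⟩

/-- The point with coordinates `s = σ`, `t = τ` with respect to `v'`. -/
def point (v' : Fin 3 → Plane) (σ τ : ℝ) : Plane := (1 - σ - τ) • v' 0 + σ • v' 1 + τ • v' 2

theorem coord_point (h : AdjacentTriangles v v' b d) (σ τ : ℝ) :
    coordS v' (point v' σ τ) = σ ∧ coordT v' (point v' σ τ) = τ := by
  have hb : IsBary v' (point v' σ τ) (1 - σ - τ) σ τ := by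
    refine ⟨by ring, fun e => ?_⟩
    simp [point]
  exact ⟨hb.coordS_eq h.area_ne', hb.coordT_eq h.area_ne'⟩

theorem mem_inter_iff (h : AdjacentTriangles v v' b d) (x : Plane) :
    x ∈ triangle v ∩ triangle v' ↔
      0 ≤ coordS v' x ∧ coordS v' x ≤ 1 ∧ coordT v' x = 0 := by
  rw [Set.mem_inter_iff, mem_triangle_iff h.area_ne, mem_triangle_iff h.area_ne',
    (h.coord_eq x).1, (h.coord_eq x).2]
  have hd := h.neg
  constructor
  · rintro ⟨⟨-, -, h1⟩, h2, h3, h4⟩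
    have h5 : coordT v' x = 0 := le_antisymm (nonpos_of_mul_nonneg_right h1 hd) h4
    rw [h5] at h2
    exact ⟨h3, by linarith, h5⟩
  · rintro ⟨h1, h2, h3⟩
    rw [h3]
    refine ⟨⟨?_, ?_, ?_⟩, ?_, ?_, ?_⟩ <;> linarith

theorem eq_point (h : AdjacentTriangles v v' b d) (x : Plane) :
    x = point v' (coordS v' x) (coordT v' x) := by
  ext e
  rw [(isBary_coord h.area_ne' x).2 e]
  simp [point]

/-- Smoothness of order `r` forces the expansions of both splines in powers of `t`, at each point of
the edge next to the face of `f`, to agree up to order `r`. -/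
theorem coeff_eval_eq (h : AdjacentTriangles v v' b d) {c c' : ℕ → ℝ} {r : ℕ}
    (hm : MeetsSmoothly r (triangle v) (triangle v') (bcSpline v c) (bcSpline v' c'))
    {f : Triple} {σ : ℝ} (hσ : OnEdgeOf f σ) {k : ℕ} (hk : k ≤ r) :
    ((faceSum f c').coeff k).eval σ = ((shear b d (faceSum f c)).coeff k).eval σ := by
  classical
  obtain ⟨heq, hsm⟩ := hm
  set u : Plane → ℝ := (triangle v).piecewise (bcSpline v c) (bcSpline v' c') with hu
  obtain ⟨h0, h1⟩ := hσ.pos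
  -- Both splines are restricted to a line that crosses the edge.
  have hpt : ∀ τ, coordS v' (point v' σ τ) = σ ∧ coordT v' (point v' σ τ) = τ := h.coord_point σ
  have hpt' : ∀ τ, coordS v (point v' σ τ) = σ + b * τ ∧ coordT v (point v' σ τ) = d * τ := by
    intro τ
    rw [(h.coord_eq _).1, (h.coord_eq _).2, (hpt τ).1, (hpt τ).2]
    exact ⟨rfl, rfl⟩
  have hc1 : ContinuousAt (fun τ : ℝ => (σ, τ)) 0 := by fun_prop
  have hc2 : ContinuousAt (fun τ : ℝ => (σ + b * τ, d * τ)) 0 := by fun_prop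
  have hs1 : ∀ᶠ τ in 𝓝 (0 : ℝ), SameSide f σ τ :=
    hc1.eventually hσ.eventually_sameSide
  have hs2 : ∀ᶠ τ in 𝓝 (0 : ℝ), SameSide f (σ + b * τ) (d * τ) := by
    refine hc2.eventually (p := fun p : ℝ × ℝ => SameSide f p.1 p.2) ?_
    simpa using hσ.eventually_sameSide
  have hev : ∀ g : ℝ → ℝ, Continuous g → 0 < g 0 → ∀ᶠ τ in 𝓝 (0 : ℝ), 0 < g τ :=
    fun g hg h0 => hg.continuousAt.eventually (lt_mem_nhds h0)
  have hT : ∀ᶠ τ in 𝓝 (0 : ℝ), 0 ≤ τ → point v' σ τ ∈ triangle v' := by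
    filter_upwards [hev (fun τ => 1 - σ - τ) (by fun_prop) (by simpa using h1)] with τ hτ hτ0
    rw [mem_triangle_iff h.area_ne', (hpt τ).1, (hpt τ).2]
    exact ⟨hτ.le, h0.le, hτ0⟩
  have hS : ∀ᶠ τ in 𝓝 (0 : ℝ), τ ≤ 0 → point v' σ τ ∈ triangle v := by
    filter_upwards [hev (fun τ => 1 - (σ + b * τ) - d * τ) (by fun_prop) (by simpa using h1),
      hev (fun τ => σ + b * τ) (by fun_prop) (by simpa using h0)] with τ hτ1 hτ2 hτ0
    rw [mem_triangle_iff h.area_ne, (hpt' τ).1, (hpt' τ).2]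
    exact ⟨hτ1.le, hτ2.le, mul_nonneg_of_nonpos_of_nonpos h.neg.le hτ0⟩
  -- The function that the splines make up is smooth on this line near its intersection with `e`.
  have hγ : ContDiff ℝ r (point v' σ) := by
    unfold point
    fun_prop
  have h0mem : point v' σ 0 ∈ triangle v ∩ triangle v' := by
    rw [h.mem_inter_iff, (hpt 0).1, (hpt 0).2]
    exact ⟨h0.le, h1.le, rfl⟩
  have hsmooth : ContDiffAt ℝ r (u ∘ point v' σ) 0 := by
    have h2 := (hsm _ h0mem).comp (0 : ℝ) hγ.contDiffAt.contDiffWithinAt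
      (s := point v' σ ⁻¹' (triangle v ∪ triangle v')) (Set.mapsTo_preimage _ _)
    refine h2.contDiffAt ?_
    filter_upwards [hT, hS] with τ hτ1 hτ2
    rcases le_total τ 0 with hτ | hτ
    · exact Or.inl (hτ2 hτ)
    · exact Or.inr (hτ1 hτ)
  have hright : ∀ᶠ τ in 𝓝[≥] (0 : ℝ), (u ∘ point v' σ) τ =
      ((faceSum f c').map (evalRingHom σ)).eval τ := by
    filter_upwards [nhdsWithin_le_nhds hT, nhdsWithin_le_nhds hs1, self_mem_nhdsWithin]
      with τ hτ1 hτ2 hτ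
    have hmem := hτ1 hτ
    have : u (point v' σ τ) = bcSpline v' c' (point v' σ τ) := by
      by_cases hmem' : point v' σ τ ∈ triangle v
      · rw [hu, Set.piecewise_eq_of_mem _ _ _ hmem']
        exact heq ⟨hmem', hmem⟩
      · rw [hu, Set.piecewise_eq_of_notMem _ _ _ hmem']
    rw [Function.comp_apply, this, bcSpline_eq h.area_ne' c' hmem, (hpt τ).1, (hpt τ).2,
      splineExt_eq hσ.mem_faces c' hτ2, map_evalRingHom_eval]
  have hleft : ∀ᶠ τ in 𝓝[≤] (0 : ℝ), (u ∘ point v' σ) τ =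
      ((shear b d (faceSum f c)).map (evalRingHom σ)).eval τ := by
    filter_upwards [nhdsWithin_le_nhds hS, nhdsWithin_le_nhds hs2, self_mem_nhdsWithin]
      with τ hτ1 hτ2 hτ
    have hmem := hτ1 hτ
    rw [Function.comp_apply, hu, Set.piecewise_eq_of_mem _ _ _ hmem, bcSpline_eq h.area_ne c hmem,
      (hpt' τ).1, (hpt' τ).2, splineExt_eq hσ.mem_faces c hτ2, map_evalRingHom_eval,
      evalEval_shear]
  have := coeff_eq_of_contDiffAt hsmooth hright hleft hk
  simpa [coeff_map] using this

/-- Equal expansions in powers of `t` up to order `r` on the two faces next to the edge give equal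
derivatives along the edge. The endpoints and the midpoint of the edge are reached by continuity. -/
theorem iteratedFDeriv_eq (h : AdjacentTriangles v v' b d) {c c' : ℕ → ℝ} {r : ℕ} (hr : r ≤ 3)
    (hco : ∀ f ∈ [faceA, faceB], ∀ k ≤ r,
      (faceSum f c').coeff k = (shear b d (faceSum f c)).coeff k)
    {x : Plane} (hx : x ∈ triangle v ∩ triangle v') {k : ℕ} (hk : k ≤ r) :
    iteratedFDeriv ℝ k (fun x => splineExt c (coordS v x) (coordT v x)) x =
      iteratedFDeriv ℝ k (fun x => splineExt c' (coordS v' x) (coordT v' x)) x := by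
  set F := fun x => splineExt c (coordS v x) (coordT v x) with hF
  set F' := fun x => splineExt c' (coordS v' x) (coordT v' x) with hF'
  have hFs : ContDiff ℝ 3 F := contDiff_splineExt v c
  have hFs' : ContDiff ℝ 3 F' := contDiff_splineExt v' c'
  have hk3 : ((k : ℕ) : WithTop ℕ∞) ≤ 3 := by exact_mod_cast hk.trans hr
  have hγc : Continuous fun σ : ℝ => point v' σ 0 := by
    unfold point
    fun_prop
  have hclosed : IsClosed {σ : ℝ | iteratedFDeriv ℝ k F (point v' σ 0) =
      iteratedFDeriv ℝ k F' (point v' σ 0)} :=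
    isClosed_eq ((hFs.continuous_iteratedFDeriv hk3).comp hγc)
      ((hFs'.continuous_iteratedFDeriv hk3).comp hγc)
  have hopen : ∀ f ∈ [faceA, faceB], ∀ σ, OnEdgeOf f σ →
      iteratedFDeriv ℝ k F (point v' σ 0) = iteratedFDeriv ℝ k F' (point v' σ 0) := by
    intro f hf σ hσ
    have hdvd : X ^ (r + 1) ∣ faceSum f c' - shear b d (faceSum f c) := by
      rw [X_pow_dvd_iff]
      intro m hm
      rw [coeff_sub, hco f hf m (by omega), sub_self]
    obtain ⟨R, hR⟩ := hdvd
    obtain ⟨hcS, hcT⟩ := contDiff_coord v' (n := ⊤)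
    have hpt := h.coord_point σ 0
    have hnear : F' =ᶠ[𝓝 (point v' σ 0)] fun x => F x +
        coordT v' x ^ (r + 1) * R.evalEval (coordS v' x) (coordT v' x) := by
      have hc1 : ContinuousAt (fun x => (coordS v' x, coordT v' x)) (point v' σ 0) :=
        (hcS.continuous.prodMk hcT.continuous).continuousAt
      have hc2 : ContinuousAt (fun x => (coordS v' x + b * coordT v' x, d * coordT v' x))
          (point v' σ 0) := by
        have h1 := hcS.continuous
        have h2 := hcT.continuous
        exact Continuous.continuousAt (by fun_prop)
      have h1 : ∀ᶠ x in 𝓝 (point v' σ 0), SameSide f (coordS v' x) (coordT v' x) := by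
        refine hc1.eventually (p := fun p : ℝ × ℝ => SameSide f p.1 p.2) ?_
        simp only [hpt.1, hpt.2]
        exact hσ.eventually_sameSide
      have h2 : ∀ᶠ x in 𝓝 (point v' σ 0),
          SameSide f (coordS v' x + b * coordT v' x) (d * coordT v' x) := by
        refine hc2.eventually (p := fun p : ℝ × ℝ => SameSide f p.1 p.2) ?_
        simp only [hpt.1, hpt.2, mul_zero, add_zero]
        exact hσ.eventually_sameSide
      filter_upwards [h1, h2] with x hx1 hx2
      have hev := congrArg (fun p : ℝ[X][X] => p.evalEval (coordS v' x) (coordT v' x)) hR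
      simp only [evalEval_sub, evalEval_mul, evalEval_pow, evalEval_X, evalEval_shear] at hev
      simp only [hF, hF']
      rw [(h.coord_eq x).1, (h.coord_eq x).2, splineExt_eq hσ.mem_faces c hx2,
        splineExt_eq hσ.mem_faces c' hx1]
      linarith
    have hGs : ContDiff ℝ ⊤ fun x =>
        coordT v' x ^ (r + 1) * R.evalEval (coordS v' x) (coordT v' x) :=
      (hcT.pow _).mul (contDiff_evalEval hcS hcT R)
    rw [(hnear.iteratedFDeriv ℝ k).self_of_nhds]
    have hadd := iteratedFDeriv_add_apply (x := point v' σ 0) (hFs.of_le hk3).contDiffAt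
      (hGs.of_le le_top).contDiffAt (i := k)
    have hz := iteratedFDeriv_pow_mul_eq_zero hcT (contDiff_evalEval hcS hcT R) hpt.2
      (Nat.lt_succ_of_le hk)
    have hadd' : iteratedFDeriv ℝ k (fun x => F x +
        coordT v' x ^ (r + 1) * R.evalEval (coordS v' x) (coordT v' x)) (point v' σ 0) = _ := hadd
    rw [hadd', hz, add_zero]
  have hA : Set.Icc (0 : ℝ) (1 / 2) ⊆ {σ : ℝ | iteratedFDeriv ℝ k F (point v' σ 0) =
      iteratedFDeriv ℝ k F' (point v' σ 0)} := by
    rw [← closure_Ioo (by norm_num : (0 : ℝ) ≠ 1 / 2)]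
    exact hclosed.closure_subset_iff.mpr fun σ hσ => hopen faceA (by simp) σ (Or.inl ⟨rfl, hσ⟩)
  have hB : Set.Icc (1 / 2 : ℝ) 1 ⊆ {σ : ℝ | iteratedFDeriv ℝ k F (point v' σ 0) =
      iteratedFDeriv ℝ k F' (point v' σ 0)} := by
    rw [← closure_Ioo (by norm_num : (1 / 2 : ℝ) ≠ 1)]
    exact hclosed.closure_subset_iff.mpr fun σ hσ => hopen faceB (by simp) σ (Or.inr ⟨rfl, hσ⟩)
  obtain ⟨h0, h1, h2⟩ := (h.mem_inter_iff x).mp hx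
  have hxe := h.eq_point x
  rw [h2] at hxe
  rw [hxe]
  rcases le_total (coordS v' x) (1 / 2) with hle | hle
  · exact hA ⟨h0, hle⟩
  · exact hB ⟨hle, h1⟩

theorem isClosed_triangle (v : Fin 3 → Plane) : IsClosed (triangle v) :=
  (Set.finite_range v).isClosed_convexHull ℝ

/-- The splines meet with smoothness of order at most three if and only if their expansions in powers
of `t` on the two faces along the edge agree up to this order. -/
theorem meetsSmoothly_iff (h : AdjacentTriangles v v' b d) (c c' : ℕ → ℝ) {r : ℕ} (hr : r ≤ 3) :
    MeetsSmoothly r (triangle v) (triangle v') (bcSpline v c) (bcSpline v' c') ↔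
      ∀ f ∈ [faceA, faceB], ∀ k ≤ r,
        (faceSum f c').coeff k = (shear b d (faceSum f c)).coeff k := by
  classical
  constructor
  · intro hm f hf k hk
    obtain ⟨a, a', haa', ha⟩ : ∃ a a' : ℝ, a < a' ∧ ∀ σ ∈ Set.Ioo a a', OnEdgeOf f σ := by
      simp only [List.mem_cons, List.not_mem_nil, or_false] at hf
      rcases hf with rfl | rfl
      · exact ⟨0, 1 / 2, by norm_num, fun σ hσ => Or.inl ⟨rfl, hσ⟩⟩
      · exact ⟨1 / 2, 1, by norm_num, fun σ hσ => Or.inr ⟨rfl, hσ⟩⟩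
    exact eq_of_infinite_eval_eq _ _ ((Set.Ioo_infinite haa').mono fun σ hσ =>
      h.coeff_eval_eq hm (ha σ hσ) hk)
  · intro hco
    have hd : ∀ x ∈ triangle v ∩ triangle v', ∀ k ≤ r, _ := fun x hx k hk =>
      h.iteratedFDeriv_eq hr hco hx (k := k) hk
    have hr' : ((r : ℕ) : WithTop ℕ∞) ≤ 3 := by exact_mod_cast hr
    have hsm := contDiffOn_piecewise (isClosed_triangle v) (isClosed_triangle v')
      ((contDiff_splineExt v c).of_le hr') ((contDiff_splineExt v' c').of_le hr') hd
    have hval : Set.EqOn (bcSpline v c) (bcSpline v' c') (triangle v ∩ triangle v') := by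
      intro x hx
      have h0 := congrArg (fun m => m 0) (hd x hx 0 (Nat.zero_le r))
      simp only [iteratedFDeriv_zero_apply] at h0
      rw [bcSpline_eq h.area_ne c hx.1, bcSpline_eq h.area_ne' c' hx.2]
      exact h0
    refine ⟨hval, fun x hx => ?_⟩
    have hcongr : ∀ y ∈ triangle v ∪ triangle v',
        (triangle v).piecewise (bcSpline v c) (bcSpline v' c') y =
        (triangle v).piecewise (fun x => splineExt c (coordS v x) (coordT v x))
          (fun x => splineExt c' (coordS v' x) (coordT v' x)) y := by
      intro y hy
      by_cases hyv : y ∈ triangle v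
      · rw [Set.piecewise_eq_of_mem _ _ _ hyv, Set.piecewise_eq_of_mem _ _ _ hyv,
          bcSpline_eq h.area_ne c hyv]
      · rw [Set.piecewise_eq_of_notMem _ _ _ hyv, Set.piecewise_eq_of_notMem _ _ _ hyv,
          bcSpline_eq h.area_ne' c' (hy.resolve_left hyv)]
    convert (hsm x (Or.inl hx.1)).congr hcongr (hcongr x (Or.inl hx.1))

end AdjacentTriangles

/-! ### Coefficients of the splines next to the edge -/

/-- The linear form `∑ aᵢ cᵢ`, for a list of pairs `(i, aᵢ)`. -/
def linForm (l : List (ℕ × ℤ)) (c : ℕ → ℝ) : ℝ := (l.map fun p => (p.2 : ℝ) * c p.1).sum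

/-- Entry `j` of row `k` lists the numbers `4 wᵢ a`, with `a` the coefficient of `s ^ j * t ^ k` of
`Q_i` on the face with vertices `v₁, v₄, v₇`. -/
def edgeTableA : List (List (List (ℕ × ℤ))) :=
  [[[(1, 4)],
    [(1, -40), (2, 40)],
    [(1, 160), (2, -320), (3, 160)],
    [(1, -320), (2, 960), (3, -800), (4, 160)],
    [(1, 320), (2, -1280), (3, 1360), (4, -480), (5, 80)],
    [(1, -128), (2, 640), (3, -784), (4, 368), (5, -112), (6, 16)]],
   [[(1, -40), (9, 40)],
    [(1, 320), (2, -320), (9, -320), (10, 320)],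
    [(1, -960), (2, 1920), (3, -960), (9, 960), (10, -1440), (11, 480)],
    [(1, 1280), (2, -3840), (3, 3200), (4, -640), (5, -320), (9, -1280), (10, 2240), (11, -1600),
     (12, 960)],
    [(1, -640), (2, 2560), (3, -2720), (4, 960), (5, 400), (6, -80), (9, 640), (10, -1200),
     (11, 1360), (12, -1440), (13, 80), (14, 80)]],
   [[(1, 160), (9, -320), (16, 160)],
    [(1, -960), (2, 960), (9, 1920), (10, -1440), (16, -960), (17, 480)],
    [(1, 1920), (2, -3840), (3, 1920), (5, 480), (9, -3840), (10, 4320), (11, -1440),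
     (12, -1440), (16, 1920), (17, -1440), (18, 1440)],
    [(1, -1280), (2, 3840), (3, -3200), (4, 640), (5, -480), (6, 160), (9, 2560), (10, -3360),
     (11, 2400), (12, 960), (13, -160), (14, -160), (16, -1280), (17, 1120), (18, -2400),
     (19, 480), (20, 160)]],
   [[(1, -320), (9, 960), (16, -800), (22, 160)],
    [(1, 1280), (2, -1280), (5, -320), (9, -3840), (10, 2240), (12, 960), (16, 3200),
     (17, -1600), (18, -960), (22, -640), (23, 960)],
    [(1, -1280), (2, 2560), (3, -1280), (5, 160), (6, -160), (9, 3840), (10, -3360), (11, 1120),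
     (13, 160), (14, 160), (16, -3200), (17, 2400), (19, -480), (20, -320), (22, 640),
     (23, -1440), (24, 480)]]]

/-- The same numbers for the face with vertices `v₂, v₄, v₈`. -/
def edgeTableB : List (List (List (ℕ × ℤ))) :=
  [[[(3, 16), (4, -32), (5, 48), (6, -64), (7, 40), (8, -4)],
    [(3, -80), (4, 240), (5, -400), (6, 560), (7, -360), (8, 40)],
    [(3, 160), (4, -640), (5, 1280), (6, -1920), (7, 1280), (8, -160)],
    [(3, -160), (4, 800), (5, -1920), (6, 3200), (7, -2240), (8, 320)],
    [(3, 80), (4, -480), (5, 1360), (6, -2560), (7, 1920), (8, -320)],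
    [(3, -16), (4, 112), (5, -368), (6, 784), (7, -640), (8, 128)]],
   [[(3, -160), (4, 320), (5, -80), (6, 80), (7, -40), (10, 80), (11, 80), (12, -480), (13, 240),
     (14, -80), (15, 40)],
    [(3, 640), (4, -1920), (5, 640), (6, -640), (7, 320), (10, -320), (11, -320), (12, 2880),
     (13, -1600), (14, 640), (15, -320)],
    [(3, -960), (4, 3840), (5, -1920), (6, 1920), (7, -960), (10, 480), (11, 480), (12, -5760),
     (13, 3840), (14, -1920), (15, 960)],
    [(3, 640), (4, -3200), (5, 2240), (6, -2560), (7, 1280), (10, -320), (11, -320), (12, 4800),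
     (13, -3840), (14, 2560), (15, -1280)],
    [(3, -160), (4, 960), (5, -880), (6, 1200), (7, -640), (10, 80), (11, 80), (12, -1440),
     (13, 1360), (14, -1200), (15, 640)]],
   [[(3, 640), (4, -1280), (10, -480), (11, -480), (12, 2400), (13, -640), (14, 160), (17, 160),
     (18, 480), (19, -960), (20, 160), (21, -160)],
    [(3, -1920), (4, 5760), (10, 1440), (11, 1440), (12, -11520), (13, 3360), (14, -960),
     (17, -480), (18, -1440), (19, 4320), (20, -960), (21, 960)],
    [(3, 1920), (4, -7680), (5, 480), (10, -1440), (11, -1440), (12, 15840), (13, -5760),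
     (14, 1920), (17, 480), (18, 1440), (19, -5760), (20, 1920), (21, -1920)],
    [(3, -640), (4, 3200), (5, -480), (6, 160), (10, 480), (11, 480), (12, -6720), (13, 3040),
     (14, -1440), (17, -160), (18, -480), (19, 2400), (20, -1120), (21, 1280)]],
   [[(3, -1280), (4, 2560), (10, 1120), (11, 1120), (12, -4800), (13, 640), (14, -160),
     (17, -800), (18, -1920), (19, 3360), (20, -160), (21, 160), (23, 480), (24, -480), (25, 160)],
    [(3, 2560), (4, -7680), (5, -320), (10, -2240), (11, -2240), (12, 16320), (13, -2240),
     (14, 640), (17, 1600), (18, 3840), (19, -10560), (20, 640), (21, -640), (23, -960),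
     (24, 1920), (25, -640)],
    [(3, -1280), (4, 5120), (5, 160), (6, -160), (10, 1120), (11, 1120), (12, -11520),
     (13, 2080), (14, -480), (17, -800), (18, -1920), (19, 7200), (20, -960), (21, 640),
     (23, 480), (24, -1440), (25, 640)]]]

set_option maxHeartbeats 0 in
/-- The tables are correct, and they contain all coefficients of `t ^ k` for `k ≤ 3`. -/
theorem edgeTable_check :
    ∀ k < 4, (List.range (6 - k)).map (edgeColumn faceA k) = edgeTableA.getD k [] ∧
      (List.range (6 - k)).map (edgeColumn faceB k) = edgeTableB.getD k [] ∧
      ∀ i ∈ List.range' 1 39, ((memoPoly faceA 5 (bcCode i)).getD k []).length ≤ 6 - k ∧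
        ((memoPoly faceB 5 (bcCode i)).getD k []).length ≤ 6 - k := by
  decide +kernel

/-- Coefficients of the spline with coefficients `c` on a face next to the edge, given the table of
this face. -/
def edgeCoeff (T : List (List (List (ℕ × ℤ)))) (k j : ℕ) (c : ℕ → ℝ) : ℝ :=
  linForm ((T.getD k []).getD j []) c / 4

theorem sum_mul_coef (f : Triple) (k j : ℕ) (c : ℕ → ℝ) :
    ((faceSum f c).coeff k).coeff j = linForm (edgeColumn f k j) c / 4 := by
  have hw : ∀ i ∈ Finset.Icc 1 39, bcWeight i = (weight4 i : ℝ) / 4 := by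
    intro i hi
    rw [Finset.mem_Icc] at hi
    obtain ⟨h1, h2⟩ := hi
    interval_cases i <;> norm_num [bcWeight, weight4]
  have hl : ∀ l : List ℕ, linForm (l.filterMap fun i =>
      let a := coef (memoPoly f 5 (bcCode i)) k j
      bif intIsZero a then none else some (i, weight4 i * a)) c =
      (l.map fun i => (weight4 i : ℝ) * coef (facePoly f 5 (bcCode i)) k j * c i).sum := by
    intro l
    induction l with
    | nil => rfl
    | cons i l ih =>
      rw [List.map_cons, List.sum_cons, ← ih, memoPoly_eq]
      cases h : intIsZero (coef (facePoly f 5 (bcCode i)) k j) with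
      | true =>
        rw [List.filterMap_cons_none (by simp [h]), intIsZero_eq_true.mp h]
        simp
      | false =>
        rw [List.filterMap_cons_some
          (b := (i, weight4 i * coef (facePoly f 5 (bcCode i)) k j)) (by simp [h])]
        simp [linForm]
  have hset : Finset.Icc 1 39 = (List.range' 1 39).toFinset := by decide
  rw [edgeColumn, hl, faceSum, finsetSum_coeff, finsetSum_coeff, Finset.sum_congr rfl
    (g := fun i => (weight4 i : ℝ) * coef (facePoly f 5 (bcCode i)) k j * c i / 4)]
  · rw [← Finset.sum_div, hset, List.sum_toFinset _ (List.nodup_range' (step := 1))]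
  · intro i hi
    rw [coeff_C_mul, coeff_C_mul, coeff_toPoly, hw i hi]
    ring

theorem coeff_faceSum {k j : ℕ} (hk : k < 4) (hj : j < 6 - k) (c : ℕ → ℝ) :
    ((faceSum faceA c).coeff k).coeff j = edgeCoeff edgeTableA k j c ∧
    ((faceSum faceB c).coeff k).coeff j = edgeCoeff edgeTableB k j c := by
  obtain ⟨hA, hB, -⟩ := edgeTable_check k hk
  rw [sum_mul_coef, sum_mul_coef, edgeCoeff, edgeCoeff, ← hA, ← hB]
  simp [List.getD_eq_getElem?_getD, hj]

theorem coeff_faceSum_eq_zero {k j : ℕ} (hk : k < 4) (hj : 6 - k ≤ j) (c : ℕ → ℝ) :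
    ((faceSum faceA c).coeff k).coeff j = 0 ∧ ((faceSum faceB c).coeff k).coeff j = 0 := by
  obtain ⟨-, -, hlen⟩ := edgeTable_check k hk
  rw [faceSum, faceSum, finsetSum_coeff, finsetSum_coeff, finsetSum_coeff, finsetSum_coeff]
  refine ⟨Finset.sum_eq_zero fun i hi => ?_, Finset.sum_eq_zero fun i hi => ?_⟩ <;>
  · have hi' : i ∈ List.range' 1 39 := by
      rw [Finset.mem_Icc] at hi
      rw [List.mem_range'_1]
      omega
    have h := hlen i hi'
    rw [memoPoly_eq, memoPoly_eq] at h
    rw [coeff_C_mul, coeff_C_mul, coeff_toPoly, coef,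
      List.getD_eq_default _ _ (by first | exact h.1.trans hj | exact h.2.trans hj)]
    simp

/-- The conditions that compare the coefficients of `t ^ k` next to the edge. -/
def EdgeEq (k : ℕ) (b d : ℝ) (c c' : ℕ → ℝ) : Prop :=
  ∀ T ∈ [edgeTableA, edgeTableB], ∀ j < 6 - k, edgeCoeff T k j c' =
    ∑ i ∈ Finset.range (k + 1),
      d ^ i * b ^ (k - i) * ((j + (k - i)).choose (k - i) : ℕ) * edgeCoeff T i (j + (k - i)) c

theorem edgeEq_iff {k : ℕ} (hk : k < 4) (b d : ℝ) (c c' : ℕ → ℝ) :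
    (∀ f ∈ [faceA, faceB], (faceSum f c').coeff k = (shear b d (faceSum f c)).coeff k) ↔
      EdgeEq k b d c c' := by
  have key : ∀ (f : Triple) (T : List (List (List (ℕ × ℤ)))),
      (∀ k < 4, ∀ (c : ℕ → ℝ),
        (∀ j < 6 - k, ((faceSum f c).coeff k).coeff j = edgeCoeff T k j c) ∧
        ∀ j, 6 - k ≤ j → ((faceSum f c).coeff k).coeff j = 0) →
      ((faceSum f c').coeff k = (shear b d (faceSum f c)).coeff k ↔
        ∀ j < 6 - k, edgeCoeff T k j c' = ∑ i ∈ Finset.range (k + 1),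
          d ^ i * b ^ (k - i) * ((j + (k - i)).choose (k - i) : ℕ) *
            edgeCoeff T i (j + (k - i)) c) := by
    intro f T hT
    have hsh : ∀ j, ((shear b d (faceSum f c)).coeff k).coeff j = ∑ i ∈ Finset.range (k + 1),
        d ^ i * b ^ (k - i) * (((j + (k - i)).choose (k - i) : ℕ) *
          ((faceSum f c).coeff i).coeff (j + (k - i))) := by
      intro j
      rw [coeff_shear, finsetSum_coeff]
      refine Finset.sum_congr rfl fun i _ => ?_
      rw [coeff_C_mul, hasseDeriv_coeff]
    rw [Polynomial.ext_iff]
    constructor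
    · intro h j hj
      rw [← (hT k hk c').1 j hj, h j, hsh]
      refine Finset.sum_congr rfl fun i hi => ?_
      rw [Finset.mem_range] at hi
      rw [(hT i (by omega) c).1 _ (by omega)]
      ring
    · intro h j
      rw [hsh]
      rcases lt_or_ge j (6 - k) with hj | hj
      · rw [(hT k hk c').1 j hj, h j hj]
        refine Finset.sum_congr rfl fun i hi => ?_
        rw [Finset.mem_range] at hi
        rw [(hT i (by omega) c).1 _ (by omega)]
        ring
      · rw [(hT k hk c').2 j hj]
        refine (Finset.sum_eq_zero fun i hi => ?_).symm
        rw [Finset.mem_range] at hi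
        rw [(hT i (by omega) c).2 _ (by omega), mul_zero, mul_zero]
  have hA := key faceA edgeTableA fun k hk c =>
    ⟨fun j hj => (coeff_faceSum hk hj c).1, fun j hj => (coeff_faceSum_eq_zero hk hj c).1⟩
  have hB := key faceB edgeTableB fun k hk c =>
    ⟨fun j hj => (coeff_faceSum hk hj c).2, fun j hj => (coeff_faceSum_eq_zero hk hj c).2⟩
  simp only [List.forall_mem_cons, List.not_mem_nil, false_imp_iff, implies_true, and_true, EdgeEq]
  rw [hA, hB]

/-! ### Coefficient conditions and linear relations -/

theorem edgeEq_zero_expand {b d : ℝ} {c c' : ℕ → ℝ} : EdgeEq 0 b d c c' ↔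
    (∀ T ∈ [edgeTableA, edgeTableB],
      edgeCoeff T 0 0 c' = edgeCoeff T 0 0 c ∧
      edgeCoeff T 0 1 c' = edgeCoeff T 0 1 c ∧
      edgeCoeff T 0 2 c' = edgeCoeff T 0 2 c ∧
      edgeCoeff T 0 3 c' = edgeCoeff T 0 3 c ∧
      edgeCoeff T 0 4 c' = edgeCoeff T 0 4 c ∧
      edgeCoeff T 0 5 c' = edgeCoeff T 0 5 c) := by
  have hset : Finset.range 6 = {0, 1, 2, 3, 4, 5} := rfl
  simp only [EdgeEq, ← Finset.mem_range, Nat.reduceSub, hset, Finset.forall_mem_insert,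
    Finset.mem_singleton, forall_eq]
  simp

theorem edgeEq_one_expand {b d : ℝ} {c c' : ℕ → ℝ} : EdgeEq 1 b d c c' ↔
    (∀ T ∈ [edgeTableA, edgeTableB],
      edgeCoeff T 1 0 c' = b * edgeCoeff T 0 1 c + d * edgeCoeff T 1 0 c ∧
      edgeCoeff T 1 1 c' = b * 2 * edgeCoeff T 0 2 c + d * edgeCoeff T 1 1 c ∧
      edgeCoeff T 1 2 c' = b * 3 * edgeCoeff T 0 3 c + d * edgeCoeff T 1 2 c ∧
      edgeCoeff T 1 3 c' = b * 4 * edgeCoeff T 0 4 c + d * edgeCoeff T 1 3 c ∧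
      edgeCoeff T 1 4 c' = b * 5 * edgeCoeff T 0 5 c + d * edgeCoeff T 1 4 c) := by
  have hset : Finset.range 5 = {0, 1, 2, 3, 4} := rfl
  simp only [EdgeEq, ← Finset.mem_range, Nat.reduceSub, hset, Finset.forall_mem_insert,
    Finset.mem_singleton, forall_eq]
  simp [Finset.sum_range_succ]

theorem edgeEq_two_expand {b d : ℝ} {c c' : ℕ → ℝ} : EdgeEq 2 b d c c' ↔
    (∀ T ∈ [edgeTableA, edgeTableB],
      edgeCoeff T 2 0 c' = b ^ 2 * edgeCoeff T 0 2 c + d * b * edgeCoeff T 1 1 c +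
        d ^ 2 * edgeCoeff T 2 0 c ∧
      edgeCoeff T 2 1 c' = b ^ 2 * 3 * edgeCoeff T 0 3 c + d * b * 2 * edgeCoeff T 1 2 c +
        d ^ 2 * edgeCoeff T 2 1 c ∧
      edgeCoeff T 2 2 c' = b ^ 2 * 6 * edgeCoeff T 0 4 c + d * b * 3 * edgeCoeff T 1 3 c +
        d ^ 2 * edgeCoeff T 2 2 c ∧
      edgeCoeff T 2 3 c' = b ^ 2 * 10 * edgeCoeff T 0 5 c + d * b * 4 * edgeCoeff T 1 4 c +
        d ^ 2 * edgeCoeff T 2 3 c) := by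
  have hset : Finset.range 4 = {0, 1, 2, 3} := rfl
  simp only [EdgeEq, ← Finset.mem_range, Nat.reduceSub, hset, Finset.forall_mem_insert,
    Finset.mem_singleton, forall_eq]
  simp [Finset.sum_range_succ, Nat.choose]

theorem edgeEq_three_expand {b d : ℝ} {c c' : ℕ → ℝ} : EdgeEq 3 b d c c' ↔
    (∀ T ∈ [edgeTableA, edgeTableB],
      edgeCoeff T 3 0 c' = b ^ 3 * edgeCoeff T 0 3 c + d * b ^ 2 * edgeCoeff T 1 2 c +
        d ^ 2 * b * edgeCoeff T 2 1 c + d ^ 3 * edgeCoeff T 3 0 c ∧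
      edgeCoeff T 3 1 c' = b ^ 3 * 4 * edgeCoeff T 0 4 c + d * b ^ 2 * 3 * edgeCoeff T 1 3 c +
        d ^ 2 * b * 2 * edgeCoeff T 2 2 c + d ^ 3 * edgeCoeff T 3 1 c ∧
      edgeCoeff T 3 2 c' = b ^ 3 * 10 * edgeCoeff T 0 5 c + d * b ^ 2 * 6 * edgeCoeff T 1 4 c +
        d ^ 2 * b * 3 * edgeCoeff T 2 3 c + d ^ 3 * edgeCoeff T 3 2 c) := by
  have hset : Finset.range 3 = {0, 1, 2} := rfl
  simp only [EdgeEq, ← Finset.mem_range, Nat.reduceSub, hset, Finset.forall_mem_insert,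
    Finset.mem_singleton, forall_eq]
  simp [Finset.sum_range_succ, Nat.choose]

theorem c0Relations_iff {c c' : ℕ → ℝ} : C0Relations c c' ↔
    c' 1 = c 1 ∧ c' 2 = c 2 ∧ c' 3 = c 3 ∧ c' 4 = c 4 ∧ c' 5 = c 5 ∧ c' 6 = c 6 ∧ c' 7 = c 7 ∧
      c' 8 = c 8 := by
  have hset : Finset.Icc 1 8 = {1, 2, 3, 4, 5, 6, 7, 8} := rfl
  simp only [C0Relations, hset, Finset.forall_mem_insert, Finset.mem_singleton, forall_eq]

/-- In this proof and the next three, `aⱼ` and `bⱼ` are the equations for the coefficients of `s ^ j`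
on the faces `faceA` and `faceB`, and `rᵢ` is the relation for `c' i`. The multipliers are constants,
because `b` and `d` occur only in the terms of the equations that contain the coefficients `c`. -/
theorem edgeEq_zero_iff {b d : ℝ} {c c' : ℕ → ℝ} :
    EdgeEq 0 b d c c' ↔ C0Relations c c' := by
  rw [c0Relations_iff]
  rw [edgeEq_zero_expand, List.forall_mem_cons, List.forall_mem_singleton]
  constructor
  · rintro ⟨⟨a0, a1, a2, a3, a4, a5⟩, b0, b1, b2, b3, b4, b5⟩
    simp only [edgeCoeff, edgeTableA, edgeTableB, linForm, List.getD_cons_zero,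
      List.getD_cons_succ, List.map_cons, List.map_nil, List.sum_cons, List.sum_nil, Int.cast_neg,
      Int.cast_ofNat] at a0 a1 a2 a3 a4 a5 b0 b1 b2 b3 b4 b5
    refine ⟨?_, ?_, ?_, ?_, ?_, ?_, ?_, ?_⟩
    · linear_combination a0
    · linear_combination a0 + 1 / 10 * a1
    · linear_combination a0 + 1 / 5 * a1 + 1 / 40 * a2
    · linear_combination a0 + 2 / 5 * a1 + 1 / 8 * a2 + 1 / 40 * a3
    · linear_combination a0 + 3 / 5 * a1 + 13 / 40 * a2 + 3 / 20 * a3 + 1 / 20 * a4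
    · linear_combination a0 + 4 / 5 * a1 + 5 / 8 * a2 + 19 / 40 * a3 + 7 / 20 * a4 + 1 / 4
        * a5
    · linear_combination 4 / 5 * a1 + 4 / 5 * a2 + 7 / 10 * a3 + 3 / 5 * a4 + 1 / 2 * a5 +
        b0 + 1 / 10 * b1
    · linear_combination -8 * a0 + a2 + a3 + a4 + a5 + 9 * b0 + b1
  · rintro ⟨r1, r2, r3, r4, r5, r6, r7, r8⟩
    simp only [edgeCoeff, edgeTableA, edgeTableB, linForm, List.getD_cons_zero,
      List.getD_cons_succ, List.map_cons, List.map_nil, List.sum_cons, List.sum_nil, Int.cast_neg,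
      Int.cast_ofNat]
    refine ⟨⟨?_, ?_, ?_, ?_, ?_, ?_⟩, ?_, ?_, ?_, ?_, ?_, ?_⟩
    · linear_combination r1
    · linear_combination -10 * r1 + 10 * r2
    · linear_combination 40 * r1 - 80 * r2 + 40 * r3
    · linear_combination -80 * r1 + 240 * r2 - 200 * r3 + 40 * r4
    · linear_combination 80 * r1 - 320 * r2 + 340 * r3 - 120 * r4 + 20 * r5
    · linear_combination -32 * r1 + 160 * r2 - 196 * r3 + 92 * r4 - 28 * r5 + 4 * r6
    · linear_combination 4 * r3 - 8 * r4 + 12 * r5 - 16 * r6 + 10 * r7 - r8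
    · linear_combination -20 * r3 + 60 * r4 - 100 * r5 + 140 * r6 - 90 * r7 + 10 * r8
    · linear_combination 40 * r3 - 160 * r4 + 320 * r5 - 480 * r6 + 320 * r7 - 40 * r8
    · linear_combination -40 * r3 + 200 * r4 - 480 * r5 + 800 * r6 - 560 * r7 + 80 * r8
    · linear_combination 20 * r3 - 120 * r4 + 340 * r5 - 640 * r6 + 480 * r7 - 80 * r8
    · linear_combination -4 * r3 + 28 * r4 - 92 * r5 + 196 * r6 - 160 * r7 + 32 * r8

theorem edgeEq_one_iff {b d : ℝ} {c c' : ℕ → ℝ} (h0 : C0Relations c c') :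
    EdgeEq 1 b d c c' ↔ C1Relations (1 - b - d) b d c c' := by
  obtain ⟨r1, r2, r3, r4, r5, r6, r7, r8⟩ := c0Relations_iff.mp h0
  rw [edgeEq_one_expand, List.forall_mem_cons, List.forall_mem_singleton]
  constructor
  · rintro ⟨⟨a0, a1, a2, a3, a4⟩, b0, b1, b2, b3, b4⟩
    simp only [edgeCoeff, edgeTableA, edgeTableB, linForm, List.getD_cons_zero,
      List.getD_cons_succ, List.map_cons, List.map_nil, List.sum_cons, List.sum_nil, Int.cast_neg,
      Int.cast_ofNat] at a0 a1 a2 a3 a4 b0 b1 b2 b3 b4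
    refine ⟨?_, ?_, ?_, ?_, ?_, ?_, ?_⟩
    · linear_combination 1 / 10 * a0 + r1
    · linear_combination 1 / 10 * a0 + 1 / 80 * a1 + r2
    · linear_combination 1 / 10 * a0 + 3 / 80 * a1 + 1 / 120 * a2 - r2 + 2 * r3
    · linear_combination 1 / 15 * a0 + 1 / 30 * a1 + 1 / 72 * a2 + 1 / 240 * a3 + 2 / 3 *
        r4 + 1 / 3 * r5
    · linear_combination 1 / 20 * a1 + 1 / 30 * a2 + 1 / 80 * a3 + 1 / 10 * b0 + 1 / 80 *
        b1 + r5
    · linear_combination 1 / 5 * a0 + 1 / 10 * a1 + 3 / 40 * a2 + 1 / 16 * a3 + 1 / 20 *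
        a4 - 1 / 10 * b0 - 1 / 80 * b1 + r6
    · linear_combination 4 / 5 * a0 + 1 / 5 * a1 + 1 / 10 * a2 + 1 / 10 * a3 + 1 / 10 * a4
        - 7 / 10 * b0 - 1 / 10 * b1 + r7
  · rintro ⟨r9, r10, r11, r12, r13, r14, r15⟩
    simp only [edgeCoeff, edgeTableA, edgeTableB, linForm, List.getD_cons_zero,
      List.getD_cons_succ, List.map_cons, List.map_nil, List.sum_cons, List.sum_nil, Int.cast_neg,
      Int.cast_ofNat]
    refine ⟨⟨?_, ?_, ?_, ?_, ?_⟩, ?_, ?_, ?_, ?_, ?_⟩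
    · linear_combination -10 * r1 + 10 * r9
    · linear_combination 80 * r1 - 80 * r2 - 80 * r9 + 80 * r10
    · linear_combination -240 * r1 + 480 * r2 - 240 * r3 + 240 * r9 - 360 * r10 + 120 *
        r11
    · linear_combination 320 * r1 - 960 * r2 + 800 * r3 - 160 * r4 - 80 * r5 - 320 * r9 +
        560 * r10 - 400 * r11 + 240 * r12
    · linear_combination -160 * r1 + 640 * r2 - 680 * r3 + 240 * r4 + 100 * r5 - 20 * r6 +
        160 * r9 - 300 * r10 + 340 * r11 - 360 * r12 + 20 * r13 + 20 * r14
    · linear_combination -40 * r3 + 80 * r4 - 20 * r5 + 20 * r6 - 10 * r7 + 20 * r10 + 20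
        * r11 - 120 * r12 + 60 * r13 - 20 * r14 + 10 * r15
    · linear_combination 160 * r3 - 480 * r4 + 160 * r5 - 160 * r6 + 80 * r7 - 80 * r10 -
        80 * r11 + 720 * r12 - 400 * r13 + 160 * r14 - 80 * r15
    · linear_combination -240 * r3 + 960 * r4 - 480 * r5 + 480 * r6 - 240 * r7 + 120 * r10
        + 120 * r11 - 1440 * r12 + 960 * r13 - 480 * r14 + 240 * r15
    · linear_combination 160 * r3 - 800 * r4 + 560 * r5 - 640 * r6 + 320 * r7 - 80 * r10 -
        80 * r11 + 1200 * r12 - 960 * r13 + 640 * r14 - 320 * r15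
    · linear_combination -40 * r3 + 240 * r4 - 220 * r5 + 300 * r6 - 160 * r7 + 20 * r10 +
        20 * r11 - 360 * r12 + 340 * r13 - 300 * r14 + 160 * r15

theorem edgeEq_two_iff {b d : ℝ} {c c' : ℕ → ℝ} (h0 : C0Relations c c')
    (h1 : C1Relations (1 - b - d) b d c c') :
    EdgeEq 2 b d c c' ↔ C2Relations (1 - b - d) b d c c' := by
  obtain ⟨r1, r2, r3, r4, r5, r6, r7, r8⟩ := c0Relations_iff.mp h0
  obtain ⟨r9, r10, r11, r12, r13, r14, r15⟩ := h1
  rw [edgeEq_two_expand, List.forall_mem_cons, List.forall_mem_singleton]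
  constructor
  · rintro ⟨⟨a0, a1, a2, a3⟩, b0, b1, b2, b3⟩
    simp only [edgeCoeff, edgeTableA, edgeTableB, linForm, List.getD_cons_zero,
      List.getD_cons_succ, List.map_cons, List.map_nil, List.sum_cons, List.sum_nil, Int.cast_neg,
      Int.cast_ofNat] at a0 a1 a2 a3 b0 b1 b2 b3
    refine ⟨?_, ?_, ?_, ?_, ?_, ?_⟩
    · linear_combination 1 / 40 * a0 - r1 + 2 * r9
    · linear_combination 1 / 20 * a0 + 1 / 120 * a1 - 2 * r2 + 3 * r10
    · linear_combination 1 / 60 * a0 + 1 / 120 * a1 + 1 / 360 * a2 + 2 / 3 * r2 - 4 / 3 *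
        r3 - 1 / 3 * r5 + r11 + r12
    · linear_combination 1 / 30 * a0 + 1 / 90 * a1 + 1 / 360 * a2 - 1 / 60 * b0 - 1 / 360
        * b1 - 4 / 3 * r4 - 1 / 3 * r5 + 3 * r12 - 1 / 3 * r13
    · linear_combination 1 / 30 * a1 + 1 / 30 * a2 + 1 / 40 * a3 + 1 / 20 * b0 + 1 / 120 *
        b1 - r5 - r6 + 2 * r13 + r14
    · linear_combination -1 / 10 * a0 + 1 / 40 * a2 + 1 / 40 * a3 + 1 / 8 * b0 + 1 / 40 *
        b1 - r6 + 2 * r14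
  · rintro ⟨r16, r17, r18, r19, r20, r21⟩
    simp only [edgeCoeff, edgeTableA, edgeTableB, linForm, List.getD_cons_zero,
      List.getD_cons_succ, List.map_cons, List.map_nil, List.sum_cons, List.sum_nil, Int.cast_neg,
      Int.cast_ofNat]
    refine ⟨⟨?_, ?_, ?_, ?_⟩, ?_, ?_, ?_, ?_⟩
    · linear_combination 40 * r1 - 80 * r9 + 40 * r16
    · linear_combination -240 * r1 + 240 * r2 + 480 * r9 - 360 * r10 - 240 * r16 + 120 *
        r17
    · linear_combination 480 * r1 - 960 * r2 + 480 * r3 + 120 * r5 - 960 * r9 + 1080 * r10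
        - 360 * r11 - 360 * r12 + 480 * r16 - 360 * r17 + 360 * r18
    · linear_combination -320 * r1 + 960 * r2 - 800 * r3 + 160 * r4 - 120 * r5 + 40 * r6 +
        640 * r9 - 840 * r10 + 600 * r11 + 240 * r12 - 40 * r13 - 40 * r14 - 320 * r16 +
        280 * r17 - 600 * r18 + 120 * r19 + 40 * r20
    · linear_combination 160 * r3 - 320 * r4 - 120 * r10 - 120 * r11 + 600 * r12 - 160 *
        r13 + 40 * r14 + 40 * r17 + 120 * r18 - 240 * r19 + 40 * r20 - 40 * r21
    · linear_combination -480 * r3 + 1440 * r4 + 360 * r10 + 360 * r11 - 2880 * r12 + 840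
        * r13 - 240 * r14 - 120 * r17 - 360 * r18 + 1080 * r19 - 240 * r20 + 240 * r21
    · linear_combination 480 * r3 - 1920 * r4 + 120 * r5 - 360 * r10 - 360 * r11 + 3960 *
        r12 - 1440 * r13 + 480 * r14 + 120 * r17 + 360 * r18 - 1440 * r19 + 480 * r20 -
        480 * r21
    · linear_combination -160 * r3 + 800 * r4 - 120 * r5 + 40 * r6 + 120 * r10 + 120 * r11
        - 1680 * r12 + 760 * r13 - 360 * r14 - 40 * r17 - 120 * r18 + 600 * r19 - 280 *
        r20 + 320 * r21

/-- The coefficients of `t ^ 3` give six equations for the four unknowns `c' 22, …, c' 25`; `rc` is the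
combination of them that is free of unknowns. -/
theorem edgeEq_three_iff {b d : ℝ} {c c' : ℕ → ℝ} (h0 : C0Relations c c')
    (h1 : C1Relations (1 - b - d) b d c c') (h2 : C2Relations (1 - b - d) b d c c') :
    EdgeEq 3 b d c c' ↔ C3Relations (1 - b - d) b d c c' ∧ C3Compatibility (1 - b - d) b d c := by
  obtain ⟨r1, r2, r3, r4, r5, r6, r7, r8⟩ := c0Relations_iff.mp h0
  obtain ⟨r9, r10, r11, r12, r13, r14, r15⟩ := h1
  obtain ⟨r16, r17, r18, r19, r20, r21⟩ := h2
  rw [edgeEq_three_expand, List.forall_mem_cons, List.forall_mem_singleton]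
  constructor
  · rintro ⟨⟨a0, a1, a2⟩, b0, b1, b2⟩
    simp only [edgeCoeff, edgeTableA, edgeTableB, linForm, List.getD_cons_zero,
      List.getD_cons_succ, List.map_cons, List.map_nil, List.sum_cons, List.sum_nil, Int.cast_neg,
      Int.cast_ofNat] at a0 a1 a2 b0 b1 b2
    unfold C3Relations C3Compatibility
    refine ⟨⟨?_, ?_, ?_, ?_⟩, ?_⟩
    · linear_combination 1 / 40 * a0 + 2 * r1 - 6 * r9 + 5 * r16
    · linear_combination 1 / 60 * a0 + 1 / 240 * a1 + 4 / 3 * r2 + 1 / 3 * r5 - 7 / 3 *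
        r10 - r12 + 5 / 3 * r17 + r18
    · linear_combination 1 / 30 * a0 + 1 / 60 * a1 + 1 / 120 * a2 - 1 / 60 * b0 - 1 / 240
        * b1 + 8 / 3 * r4 + 2 / 3 * r5 + 1 / 3 * r6 - 7 * r12 - 1 / 3 * r14 + 4 * r19 + 2
        / 3 * r20
    · linear_combination 1 / 10 * a0 + 1 / 20 * a1 + 1 / 40 * a2 - 3 / 40 * b0 - 1 / 40 *
        b1 + r5 + r6 - 3 * r13 + 3 * r20 - r21
    · linear_combination -1 / 40 * a0 - 1 / 160 * a1 + 1 / 40 * b0 + 1 / 160 * b1 - 2 * r2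
        + 4 * r3 - 4 * r4 - 7 / 2 * r11 + 6 * r12 - 1 / 2 * r13 + 9 / 2 * r18 - 9 / 2 *
        r19
  · rintro ⟨⟨r22, r23, r24, r25⟩, rc⟩
    unfold C3Compatibility at rc
    simp only [edgeCoeff, edgeTableA, edgeTableB, linForm, List.getD_cons_zero,
      List.getD_cons_succ, List.map_cons, List.map_nil, List.sum_cons, List.sum_nil, Int.cast_neg,
      Int.cast_ofNat]
    refine ⟨⟨?_, ?_, ?_⟩, ?_, ?_, ?_⟩
    · linear_combination -80 * r1 + 240 * r9 - 200 * r16 + 40 * r22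
    · linear_combination 320 * r1 - 320 * r2 - 80 * r5 - 960 * r9 + 560 * r10 + 240 * r12
        + 800 * r16 - 400 * r17 - 240 * r18 - 160 * r22 + 240 * r23
    · linear_combination -320 * r1 + 640 * r2 - 320 * r3 + 40 * r5 - 40 * r6 + 960 * r9 -
        840 * r10 + 280 * r11 + 40 * r13 + 40 * r14 - 800 * r16 + 600 * r17 - 120 * r19 -
        80 * r20 + 160 * r22 - 360 * r23 + 120 * r24 + 80 * rc
    · linear_combination -320 * r3 + 640 * r4 + 280 * r10 + 280 * r11 - 1200 * r12 + 160 *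
        r13 - 40 * r14 - 200 * r17 - 480 * r18 + 840 * r19 - 40 * r20 + 40 * r21 + 120 *
        r23 - 120 * r24 + 40 * r25 + 80 * rc
    · linear_combination 640 * r3 - 1920 * r4 - 80 * r5 - 560 * r10 - 560 * r11 + 4080 *
        r12 - 560 * r13 + 160 * r14 + 400 * r17 + 960 * r18 - 2640 * r19 + 160 * r20 - 160
        * r21 - 240 * r23 + 480 * r24 - 160 * r25 - 160 * rc
    · linear_combination -320 * r3 + 1280 * r4 + 40 * r5 - 40 * r6 + 280 * r10 + 280 * r11
        - 2880 * r12 + 520 * r13 - 120 * r14 - 200 * r17 - 480 * r18 + 1800 * r19 - 240 *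
        r20 + 160 * r21 + 120 * r23 - 360 * r24 + 160 * r25 + 80 * rc

/-! ### The position of the two triangles -/

theorem signedArea_ne_zero_of_affineIndependent {p q r : Plane}
    (h : AffineIndependent ℝ ![p, q, r]) : signedArea p q r ≠ 0 := by
  intro h0
  have h0 : (q 0 - p 0) * (r 1 - p 1) - (r 0 - p 0) * (q 1 - p 1) = 0 := by
    rw [signedArea] at h0
    linarith
  have hqr : q = r := by
    ext e
    -- The cyclic differences of the `e`-th coordinates are the weights of an affine dependence.
    have := affineIndependent_iff.mp h Finset.univ ![q e - r e, r e - p e, p e - q e]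
      (by simp [Fin.sum_univ_three]) (by
        ext i
        simp only [Fin.sum_univ_three, Matrix.cons_val, PiLp.add_apply, PiLp.smul_apply,
          smul_eq_mul, PiLp.zero_apply]
        fin_cases e <;> fin_cases i <;> simp only [Fin.zero_eta, Fin.mk_one] <;> linarith)
      0 (Finset.mem_univ _)
    simpa [sub_eq_zero] using this
  exact absurd (h.injective (a₁ := 1) (a₂ := 2) (by simpa using hqr)) (by decide)

/-- If the triangles have only the edge in common, then the third vertices lie on opposite sides of
it: otherwise both triangles contain the points near the midpoint of the edge on one side. -/
theorem adjacentTriangles_of_inter_eq {v₁ v₂ v₃ v₃' : Plane} {b d : ℝ}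
    (hv : AffineIndependent ℝ ![v₁, v₂, v₃]) (hv' : AffineIndependent ℝ ![v₁, v₂, v₃'])
    (hedge : triangle ![v₁, v₂, v₃] ∩ triangle ![v₁, v₂, v₃'] = segment ℝ v₁ v₂)
    (hb : v₃' = (1 - b - d) • v₁ + b • v₂ + d • v₃) :
    AdjacentTriangles ![v₁, v₂, v₃] ![v₁, v₂, v₃'] b d := by
  have ha : signedArea (![v₁, v₂, v₃] 0) (![v₁, v₂, v₃] 1) (![v₁, v₂, v₃] 2) ≠ 0 :=
    signedArea_ne_zero_of_affineIndependent hv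
  have ha' : signedArea (![v₁, v₂, v₃'] 0) (![v₁, v₂, v₃'] 1) (![v₁, v₂, v₃'] 2) ≠ 0 :=
    signedArea_ne_zero_of_affineIndependent hv'
  have hd0 : d ≠ 0 := by
    rintro rfl
    apply ha'
    subst hb
    simp [signedArea]
    ring
  refine ⟨ha, ha', rfl, rfl, hb, lt_of_le_of_ne (not_lt.mp fun hd => ?_) hd0⟩
  obtain ⟨τ, hτ, h1, h2, h3⟩ : ∃ τ : ℝ, 0 < τ ∧ τ ≤ 1 / 2 ∧ -(1 / 2) ≤ b * τ ∧
      (b + d) * τ ≤ 1 / 2 := by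
    have hpos : 0 < 2 * (1 + |b| + d) := by positivity
    refine ⟨1 / (2 * (1 + |b| + d)), by positivity, ?_, ?_, ?_⟩
    · rw [div_le_div_iff₀ hpos two_pos]
      linarith [abs_nonneg b]
    · rw [mul_one_div, le_div_iff₀ hpos]
      linarith [neg_abs_le b]
    · rw [mul_one_div, div_le_div_iff₀ hpos two_pos]
      linarith [le_abs_self b]
  have hx : IsBary ![v₁, v₂, v₃] ((1 / 2 - τ) • v₁ + (1 / 2 : ℝ) • v₂ + τ • v₃')
      (1 - (1 / 2 + b * τ) - d * τ) (1 / 2 + b * τ) (d * τ) := by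
    refine ⟨by ring, fun e => ?_⟩
    simp [hb]
    ring
  have hx' : IsBary ![v₁, v₂, v₃'] ((1 / 2 - τ) • v₁ + (1 / 2 : ℝ) • v₂ + τ • v₃')
      (1 / 2 - τ) (1 / 2) τ := by
    refine ⟨by ring, fun e => ?_⟩
    simp
  have hmem : (1 / 2 - τ) • v₁ + (1 / 2 : ℝ) • v₂ + τ • v₃' ∈ segment ℝ v₁ v₂ := by
    rw [← hedge]
    refine ⟨(mem_triangle_iff ha _).mpr ?_, (mem_triangle_iff ha' _).mpr ?_⟩
    · rw [hx.coordS_eq ha, hx.coordT_eq ha]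
      exact ⟨by linarith, by linarith, by positivity⟩
    · rw [hx'.coordS_eq ha', hx'.coordT_eq ha']
      exact ⟨by linarith, by norm_num, hτ.le⟩
  obtain ⟨w₁, w₂, -, -, hw, hw'⟩ := hmem
  have h0 : IsBary ![v₁, v₂, v₃] ((1 / 2 - τ) • v₁ + (1 / 2 : ℝ) • v₂ + τ • v₃') w₁ w₂ 0 := by
    refine ⟨by linarith, fun e => ?_⟩
    rw [← hw']
    simp
  have := (hx.coordT_eq ha).symm.trans (h0.coordT_eq ha)
  exact (mul_pos hd hτ).ne' this

/-- The relation that involves only one triangle fails for some coefficients, unless the second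
triangle is the reflection of the first one in the midpoint of the edge. -/
theorem exists_not_c3Compatibility {b d : ℝ} (hd : d < 0) (h : ¬(b = 1 ∧ d = -1)) :
    ∃ c : ℕ → ℝ, ¬C3Compatibility (1 - b - d) b d c := by
  by_cases hb : 1 - b - d = b
  · refine ⟨Pi.single 11 1, fun hc => ?_⟩
    have hd' : d = 1 - 2 * b := by linarith
    have hc : b * d * (1 - b) = 0 := by
      simp [C3Compatibility, hb] at hc
      subst hd'
      linarith
    rcases mul_eq_zero.mp hc with hc | hc
    · rcases mul_eq_zero.mp hc with rfl | hc
      · linarith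
      · exact hd.ne hc
    · exact h ⟨by linarith, by linarith⟩
  · refine ⟨Pi.single 18 1, fun hc => ?_⟩
    have hc : d ^ 2 * (1 - b - d - b) = 0 := by
      simp [C3Compatibility] at hc
      linarith
    rcases mul_eq_zero.mp hc with hc | hc
    · exact hd.ne (pow_eq_zero_iff two_ne_zero |>.mp hc)
    · exact hb (by linarith)

/-- Smoothness of order at most three across the edge, in terms of the coefficients of the splines
next to the edge. -/
theorem AdjacentTriangles.meetsSmoothly_iff_edgeEq {v v' : Fin 3 → Plane} {b d : ℝ}
    (h : AdjacentTriangles v v' b d) (c c' : ℕ → ℝ) {r : ℕ} (hr : r ≤ 3) :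
    MeetsSmoothly r (triangle v) (triangle v') (bcSpline v c) (bcSpline v' c') ↔
      ∀ k ≤ r, EdgeEq k b d c c' := by
  rw [h.meetsSmoothly_iff c c' hr]
  constructor
  · exact fun H k hk => (edgeEq_iff (by omega) b d c c').mp fun f hf => H f hf k hk
  · exact fun H f hf k hk => (edgeEq_iff (by omega) b d c c').mpr (H k hk) f hf

/-- The relations for smoothness of order zero to three across the edge. -/
theorem AdjacentTriangles.meetsSmoothly_iff_relations {v v' : Fin 3 → Plane} {b d : ℝ}
    (h : AdjacentTriangles v v' b d) (c c' : ℕ → ℝ) :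
    (MeetsSmoothly 0 (triangle v) (triangle v') (bcSpline v c) (bcSpline v' c') ↔
      C0Relations c c') ∧
    (MeetsSmoothly 1 (triangle v) (triangle v') (bcSpline v c) (bcSpline v' c') ↔
      C0Relations c c' ∧ C1Relations (1 - b - d) b d c c') ∧
    (MeetsSmoothly 2 (triangle v) (triangle v') (bcSpline v c) (bcSpline v' c') ↔
      C0Relations c c' ∧ C1Relations (1 - b - d) b d c c' ∧ C2Relations (1 - b - d) b d c c') ∧
    (MeetsSmoothly 3 (triangle v) (triangle v') (bcSpline v c) (bcSpline v' c') ↔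
      C0Relations c c' ∧ C1Relations (1 - b - d) b d c c' ∧ C2Relations (1 - b - d) b d c c' ∧
        C3Relations (1 - b - d) b d c c' ∧ C3Compatibility (1 - b - d) b d c) := by
  have hsucc : ∀ n, (∀ k ≤ n + 1, EdgeEq k b d c c') ↔
      (∀ k ≤ n, EdgeEq k b d c c') ∧ EdgeEq (n + 1) b d c c' := by
    intro n
    simp only [Nat.le_succ_iff, or_imp, forall_and, forall_eq]
  have h0 : (∀ k ≤ 0, EdgeEq k b d c c') ↔ C0Relations c c' := by
    simpa using edgeEq_zero_iff
  have h1 : (∀ k ≤ 1, EdgeEq k b d c c') ↔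
      C0Relations c c' ∧ C1Relations (1 - b - d) b d c c' := by
    rw [hsucc, h0]
    exact and_congr_right fun H => edgeEq_one_iff H
  have h2 : (∀ k ≤ 2, EdgeEq k b d c c') ↔ C0Relations c c' ∧
      C1Relations (1 - b - d) b d c c' ∧ C2Relations (1 - b - d) b d c c' := by
    rw [hsucc, h1, and_assoc]
    exact and_congr_right fun H => and_congr_right fun H' => edgeEq_two_iff H H'
  have h3 : (∀ k ≤ 3, EdgeEq k b d c c') ↔ C0Relations c c' ∧ C1Relations (1 - b - d) b d c c' ∧
      C2Relations (1 - b - d) b d c c' ∧ C3Relations (1 - b - d) b d c c' ∧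
        C3Compatibility (1 - b - d) b d c := by
    rw [hsucc, h2, and_assoc, and_assoc]
    exact and_congr_right fun H => and_congr_right fun H' => and_congr_right fun H'' =>
      edgeEq_three_iff H H' H''
  exact ⟨(h.meetsSmoothly_iff_edgeEq c c' (by norm_num)).trans h0,
    (h.meetsSmoothly_iff_edgeEq c c' (by norm_num)).trans h1,
    (h.meetsSmoothly_iff_edgeEq c c' (by norm_num)).trans h2,
    (h.meetsSmoothly_iff_edgeEq c c' le_rfl).trans h3⟩

end PS12

end

theorem mainTheorem3 (v₁ v₂ v₃ v₃' : Plane)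
    (hv : AffineIndependent ℝ ![v₁, v₂, v₃])
    (hv' : AffineIndependent ℝ ![v₁, v₂, v₃'])
    (hedge : PS12.triangle ![v₁, v₂, v₃] ∩ PS12.triangle ![v₁, v₂, v₃'] = segment ℝ v₁ v₂)
    (β₁ β₂ β₃ : ℝ) (hsum : β₁ + β₂ + β₃ = 1)
    (hβ : v₃' = β₁ • v₁ + β₂ • v₂ + β₃ • v₃) :
    (∀ c c' : ℕ → ℝ,
      (PS12.MeetsSmoothly 0 (PS12.triangle ![v₁, v₂, v₃]) (PS12.triangle ![v₁, v₂, v₃'])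
          (PS12.bcSpline ![v₁, v₂, v₃] c) (PS12.bcSpline ![v₁, v₂, v₃'] c') ↔
        PS12.C0Relations c c') ∧
      (PS12.MeetsSmoothly 1 (PS12.triangle ![v₁, v₂, v₃]) (PS12.triangle ![v₁, v₂, v₃'])
          (PS12.bcSpline ![v₁, v₂, v₃] c) (PS12.bcSpline ![v₁, v₂, v₃'] c') ↔
        PS12.C0Relations c c' ∧ PS12.C1Relations β₁ β₂ β₃ c c') ∧
      (PS12.MeetsSmoothly 2 (PS12.triangle ![v₁, v₂, v₃]) (PS12.triangle ![v₁, v₂, v₃'])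
          (PS12.bcSpline ![v₁, v₂, v₃] c) (PS12.bcSpline ![v₁, v₂, v₃'] c') ↔
        PS12.C0Relations c c' ∧ PS12.C1Relations β₁ β₂ β₃ c c' ∧
          PS12.C2Relations β₁ β₂ β₃ c c') ∧
      (PS12.MeetsSmoothly 3 (PS12.triangle ![v₁, v₂, v₃]) (PS12.triangle ![v₁, v₂, v₃'])
          (PS12.bcSpline ![v₁, v₂, v₃] c) (PS12.bcSpline ![v₁, v₂, v₃'] c') ↔
        PS12.C0Relations c c' ∧ PS12.C1Relations β₁ β₂ β₃ c c' ∧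
          PS12.C2Relations β₁ β₂ β₃ c c' ∧ PS12.C3Relations β₁ β₂ β₃ c c' ∧
          PS12.C3Compatibility β₁ β₂ β₃ c)) ∧
    (v₃' ≠ v₁ + v₂ - v₃ →
      ∃ c : ℕ → ℝ, ∀ c' : ℕ → ℝ,
        ¬ PS12.MeetsSmoothly 3 (PS12.triangle ![v₁, v₂, v₃]) (PS12.triangle ![v₁, v₂, v₃'])
          (PS12.bcSpline ![v₁, v₂, v₃] c) (PS12.bcSpline ![v₁, v₂, v₃'] c')) := by
  obtain rfl : β₁ = 1 - β₂ - β₃ := by linarith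
  have h := PS12.adjacentTriangles_of_inter_eq hv hv' hedge hβ
  refine ⟨fun c c' => h.meetsSmoothly_iff_relations c c', fun hne => ?_⟩
  obtain ⟨c, hc⟩ := PS12.exists_not_c3Compatibility (b := β₂) h.neg (by
    rintro ⟨rfl, rfl⟩
    apply hne
    rw [hβ]
    module)
  exact ⟨c, fun c' hm => hc ((h.meetsSmoothly_iff_relations c c').2.2.2.mp hm).2.2.2.2⟩
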